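/- Let $(x_n)_{n\in\mathbb N}$ be a sequence in $[0,1]$. For $t\in\mathbb R$ write $\{t\}$ for its fractional part, $\|t\|$ for its distance to the nearest integer, and $(\!(t)\!)\in(-\tfrac12,\tfrac12]$ for its signed distance from the origin modulo $1$, that is, $(\!(t)\!)=\{t\}$ if $\{t\}\le\tfrac12$ and $(\!(t)\!)=\{t\}-1$ otherwise. For an integer $k\ge 2$, a real $0\le\beta\le1$, a closed rectangle $\mathcal R=[a_1,b_1]\times\cdots\times[a_{k-1},b_{k-1}]\subseteq\mathbb R^{k-1}$ and $N\ge 1$ put $$R_k(\beta;\mathcal R,N)=\frac1{N^{k-(k-1)\beta}}\,\#\Big\{(i_1,\dots,i_k)\in\{1,\dots,N\}^k \text{ pairwise distinct}:\ N^\beta\big((\!(x_{i_1}-x_{i_2})\!),\dots,(\!(x_{i_1}-x_{i_k})\!)\big)\in\mathcal R\Big\}.$$ The sequence has *Poissonian $(k,\beta)$-correlations* if $\lim_{N\to\infty}R_k(\beta;\mathcal R,N)=\lambda(\mathcal R)$ ($\lambda$ being $(k-1)$-dimensional Lebesgue measure) for every such rectangle $\mathcal R$ if $\beta>0$, and for every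 such rectangle $\mathcal R\subseteq[-\tfrac12,\tfrac12]^{k-1}$ if $\beta=0$. For $0\le\alpha\le 1$ the sequence has *weak Poissonian pair correlations with parameter $\alpha$* ($\alpha$-PPC) if $$\lim_{N\to\infty}\frac1{N^{2-\alpha}}\,\#\Big\{(m,n)\in\{1,\dots,N\}^2:\ m\ne n,\ \|x_m-x_n\|\le \frac{s}{N^\alpha}\Big\}=2s$$ for all $s>0$ if $\alpha>0$, and for all $0<s\le\tfrac12$ if $\alpha=0$. It is *uniformly distributed* if $\lim_{N\to\infty}\frac1N\#\{n\le N: x_n\in[a,b]\}=b-a$ for all $0\le a<b\le1$. **Theorem.** Let $k>2$ be an integer and $0\le\beta<1$. If a sequence $(x_n)_{n\in\mathbb N}\subseteq[0,1]$ has Poissonian $(k,\beta)$-correlations, then it also has Poissonian $(k-1,\beta)$-correlations. In particular, Poissonian $(k,\beta)$-correlations imply $\alpha$-PPC for every $0\le\alpha\le\beta$, and therefore uniform distribution. -/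

import Mathlib

open Filter Topology MeasureTheory

noncomputable section

namespace WeakCorr

/-- The distance `‖t‖` of a real number from the nearest integer. -/
def distInt (t : ℝ) : ℝ := |t - (round t : ℝ)|

/-- The signed distance of a real number from the origin modulo `1`, with values in
`(-1/2, 1/2]`. -/
def signedDistInt (t : ℝ) : ℝ :=
  if Int.fract t ≤ 1 / 2 then Int.fract t else Int.fract t - 1

/-- The pair correlation function `R₂(β; s, N)` of the sequence `x`. Sequences are indexed from
`0`, so the first `N` terms are the `x n` with `n : Fin N`. Ordered pairs are counted. -/
def pairCorr (β : ℝ) (x : ℕ → ℝ) (s : ℝ) (N : ℕ) : ℝ :=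
  1 / (N : ℝ) ^ (2 - β) *
    (Set.ncard {p : Fin N × Fin N |
      p.1 ≠ p.2 ∧ distInt (x p.1 - x p.2) ≤ s / (N : ℝ) ^ β} : ℝ)

/-- Weak Poissonian pair correlations with parameter `β` (`β`-PPC); for `β = 0` only the scales
`0 < s ≤ 1/2` are considered. -/
def HasPPC (β : ℝ) (x : ℕ → ℝ) : Prop :=
  ∀ s : ℝ, 0 < s → (β = 0 → s ≤ 1 / 2) →
    Tendsto (fun N : ℕ => pairCorr β x s N) atTop (𝓝 (2 * s))

/-- The `(k, β)`-correlation function `R_k(β; R, N)` of the sequence `x`, for `k ≥ 1`. A `k`-tuple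
of indices is a function `i` on `Fin (k - 1 + 1)`; its first entry is `i 0` and the remaining
`k - 1` entries are the `i j.succ` with `j : Fin (k - 1)`. -/
def corr (k : ℕ) (β : ℝ) (x : ℕ → ℝ) (R : Set (Fin (k - 1) → ℝ)) (N : ℕ) : ℝ :=
  1 / (N : ℝ) ^ ((k : ℝ) - ((k : ℝ) - 1) * β) *
    (Set.ncard {i : Fin (k - 1 + 1) → Fin N |
      Function.Injective i ∧
        (fun j : Fin (k - 1) => (N : ℝ) ^ β * signedDistInt (x (i 0) - x (i j.succ))) ∈ R} : ℝ)

/-- Poissonian `(k, β)`-correlations: `R_k(β; R, N)` tends to the Lebesgue measure of `R` for every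
closed rectangle `R = [a₁, b₁] × ⋯ × [a_{k-1}, b_{k-1}]`; for `β = 0` only the rectangles inside
`[-1/2, 1/2]^{k-1}` are considered. -/
def HasPoissonianCorr (k : ℕ) (β : ℝ) (x : ℕ → ℝ) : Prop :=
  ∀ a b : Fin (k - 1) → ℝ, a ≤ b →
    (β = 0 → Set.Icc a b ⊆ Set.Icc (fun _ => -(1 / 2)) (fun _ => 1 / 2)) →
    Tendsto (fun N : ℕ => corr k β x (Set.Icc a b) N) atTop
      (𝓝 ((volume : Measure (Fin (k - 1) → ℝ)).real (Set.Icc a b)))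

/-- Uniform distribution modulo `1` of a sequence in `[0, 1]`. -/
def IsUniformlyDistributed (x : ℕ → ℝ) : Prop :=
  ∀ a b : ℝ, 0 ≤ a → a < b → b ≤ 1 →
    Tendsto (fun N : ℕ => 1 / (N : ℝ) * (Set.ncard {n : Fin N | x n ∈ Set.Icc a b} : ℝ)) atTop
      (𝓝 (b - a))

end WeakCorr

end

/-! For an index p let n_p count its neighbours within s / N^β. Fixing the first index turns the
correlation of a cube into the mean over p of falling factorials of n_p, whose normalizer N^(1-β)
tends to infinity since β < 1. Put H = (n_p - m) / (2s N^(1-β)) with m = k - 2. The hypothesis gives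
limsup of the mean of H^(k-1) at most 1, so Bernoulli's inequality bounds the pair correlations
above by 2s on every scale (`eventually_pairCorr_lt`).

The matching lower bound is free once sharp cutoffs become tents: a tent sum is the second moment of
the number of points in a moving arc, hence at least the squared mean (`sq_le_tentSum`). A tent is
also an integral of cutoffs over their widths, so the upper bounds force the scaled tent sums to
tend to r^2 (`tendsto_scaledTent_self`). Cauchy–Schwarz carries this to coarser scales
(`tendsto_scaledTent_of_le`), differentiation in r gives α-PPC, and vanishing variance at α = 0
gives uniform distribution.

Now the mean of H also tends to 1, so equality holds asymptotically in Bernoulli's inequality and H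
concentrates at 1. Adjoining a side [-T, T] that contains all other sides of a rectangle inserts
exactly the weight H, which can then be dropped; this is the passage from k to k - 1
(`HasPoissonianCorr.pred`). -/

noncomputable section

namespace WeakCorr

/-! ### Counting injective tuples -/

open scoped Classical in
/-- The number of injective tuples `g` with `g j ∈ B j` for all `j`. -/
def injCount {V : Type*} [Fintype V] {m : ℕ} (B : Fin m → Finset V) : ℕ :=
  (Finset.univ.filter fun g : Fin m → V => Function.Injective g ∧ ∀ j, g j ∈ B j).card

-- An injective tail occupies exactly m elements of J, so the number of choices for the head does
-- not depend on the tail. This factorization needs J to contain every other set.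
open scoped Classical in
theorem injCount_cons {V : Type*} [Fintype V] {m : ℕ} (J : Finset V) (B : Fin m → Finset V)
    (hB : ∀ j, B j ⊆ J) :
    injCount (Fin.cons J B : Fin (m + 1) → Finset V) = injCount B * (J.card - m) := by
  unfold injCount
  rw [Finset.card_eq_sum_card_fiberwise (f := fun i : Fin (m + 1) → V => Fin.tail i)
    (t := Finset.univ.filter fun g : Fin m → V => Function.Injective g ∧ ∀ j, g j ∈ B j)]
  · rw [← smul_eq_mul, ← Finset.sum_const]
    refine Finset.sum_congr rfl fun g hg => ?_
    simp only [Finset.mem_filter, Finset.mem_univ, true_and] at hg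
    have hsub : Finset.univ.image g ⊆ J := by
      intro v hv
      obtain ⟨j, -, rfl⟩ := Finset.mem_image.1 hv
      exact hB j (hg.2 j)
    have hcard : (J \ Finset.univ.image g).card = J.card - m := by
      rw [Finset.card_sdiff_of_subset hsub, Finset.card_image_of_injective _ hg.1]
      simp
    rw [← hcard]
    symm
    refine Finset.card_bij (fun v _ => (Fin.cons v g : Fin (m + 1) → V)) ?_ ?_ ?_
    · intro v hv
      simp only [Finset.mem_sdiff, Finset.mem_image, Finset.mem_univ, true_and] at hv
      simp only [Finset.mem_filter, Finset.mem_univ, true_and, Fin.tail_cons, and_true]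
      refine ⟨Fin.cons_injective_iff.2 ⟨fun ⟨j, hj⟩ => hv.2 ⟨j, hj⟩, hg.1⟩, fun j => ?_⟩
      refine Fin.cases ?_ (fun j => ?_) j
      · simpa using hv.1
      · simpa using hg.2 j
    · intro v _ w _ hvw
      simpa using congrFun hvw 0
    · intro i hi
      simp only [Finset.mem_filter, Finset.mem_univ, true_and] at hi
      obtain ⟨⟨hinj, hmem⟩, rfl⟩ := hi
      refine ⟨i 0, ?_, Fin.cons_self_tail i⟩
      simp only [Finset.mem_sdiff, Finset.mem_image, Finset.mem_univ, true_and]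
      refine ⟨by simpa using hmem 0, ?_⟩
      rintro ⟨j, hj⟩
      exact Fin.succ_ne_zero j (hinj hj)
  · intro i hi
    simp only [Finset.coe_filter, Finset.mem_univ, true_and, Set.mem_ofPred_eq] at hi ⊢
    refine ⟨hi.1.comp (Fin.succ_injective m), fun j => ?_⟩
    simpa [Fin.tail] using hi.2 j.succ

theorem injCount_const {V : Type*} [Fintype V] (J : Finset V) (m : ℕ) :
    injCount (fun _ : Fin m => J) = J.card.descFactorial m := by
  induction m with
  | zero =>
    simp [injCount, Function.injective_of_subsingleton]
  | succ m ih =>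
    have : (fun _ : Fin (m + 1) => J) = Fin.cons J (fun _ : Fin m => J) := by
      ext j : 1
      refine Fin.cases ?_ (fun j => ?_) j <;> simp
    rw [this, injCount_cons _ _ fun _ => subset_rfl, ih, Nat.descFactorial_succ, mul_comm]

theorem injCount_le_pow {V : Type*} [Fintype V] {m : ℕ} (J : Finset V) (B : Fin m → Finset V)
    (hB : ∀ j, B j ⊆ J) : injCount B ≤ J.card ^ m := by
  classical
  refine le_trans ?_ ((injCount_const J m).le.trans (Nat.descFactorial_le_pow _ _))
  refine Finset.card_le_card fun g hg => ?_
  simp only [Finset.mem_filter, Finset.mem_univ, true_and] at hg ⊢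
  exact ⟨hg.1, fun j => hB j (hg.2 j)⟩

/-! ### Correlations as averages over the first index -/

open scoped Classical in
/-- The indices `q ≠ p` below `N` for which the rescaled signed distance of `x p` and `x q` lies
in `I`. -/
def neighbors (β : ℝ) (x : ℕ → ℝ) (N : ℕ) (I : Set ℝ) (p : Fin N) : Finset (Fin N) :=
  Finset.univ.filter fun q => p ≠ q ∧ (N : ℝ) ^ β * signedDistInt (x p - x q) ∈ I

theorem neighbors_mono (β : ℝ) (x : ℕ → ℝ) (N : ℕ) {I J : Set ℝ} (h : I ⊆ J) (p : Fin N) :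
    neighbors β x N I p ⊆ neighbors β x N J p := by
  intro q hq
  simp only [neighbors, Finset.mem_filter] at hq ⊢
  exact ⟨hq.1, hq.2.1, h hq.2.2⟩

theorem ncard_tuples_eq_sum (m : ℕ) (β : ℝ) (x : ℕ → ℝ) (a b : Fin m → ℝ) (N : ℕ) :
    Set.ncard {i : Fin (m + 1) → Fin N | Function.Injective i ∧
        (fun j : Fin m => (N : ℝ) ^ β * signedDistInt (x (i 0) - x (i j.succ))) ∈ Set.Icc a b} =
      ∑ p : Fin N, injCount fun j => neighbors β x N (Set.Icc (a j) (b j)) p := by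
  classical
  rw [Set.ncard_eq_toFinset_card', Finset.card_eq_sum_card_fiberwise
    (f := fun i : Fin (m + 1) → Fin N => i 0) (t := Finset.univ) (by intro i _; simp)]
  refine Finset.sum_congr rfl fun p _ => ?_
  unfold injCount
  symm
  refine Finset.card_bij (fun g _ => (Fin.cons p g : Fin (m + 1) → Fin N)) ?_ ?_ ?_
  · intro g hg
    simp only [Finset.mem_filter, Finset.mem_univ, true_and, neighbors] at hg
    simp only [Finset.mem_filter, Set.mem_toFinset, Set.mem_ofPred_eq, Fin.cons_zero, Fin.cons_succ,
      and_true]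
    refine ⟨Fin.cons_injective_iff.2 ⟨?_, hg.1⟩, ?_⟩
    · rintro ⟨j, hj⟩
      exact (hg.2 j).1 hj.symm
    · rw [← Set.pi_univ_Icc]
      exact fun j _ => (hg.2 j).2
  · intro g _ g' _ h
    exact Fin.cons_right_injective (α := fun _ => Fin N) p h
  · intro i hi
    simp only [Finset.mem_filter, Set.mem_toFinset, Set.mem_ofPred_eq] at hi
    obtain ⟨⟨hinj, hmem⟩, rfl⟩ := hi
    rw [← Set.pi_univ_Icc] at hmem
    refine ⟨Fin.tail i, ?_, Fin.cons_self_tail i⟩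
    simp only [Finset.mem_filter, Finset.mem_univ, true_and, neighbors]
    refine ⟨hinj.comp (Fin.succ_injective m), fun j => ⟨?_, hmem j trivial⟩⟩
    intro h
    exact Fin.succ_ne_zero j (hinj h).symm

theorem abs_signedDistInt (t : ℝ) : |signedDistInt t| = distInt t := by
  unfold signedDistInt distInt
  rw [abs_sub_round_eq_min]
  have h0 := Int.fract_nonneg t
  have h1 := Int.fract_lt_one t
  split_ifs with h
  · rw [abs_of_nonneg h0, min_eq_left (by linarith)]
  · rw [abs_of_nonpos (by linarith), min_eq_right (by linarith)]
    ring

theorem ncard_pairs_eq_sum (β : ℝ) (x : ℕ → ℝ) (s : ℝ) (N : ℕ) :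
    Set.ncard {p : Fin N × Fin N | p.1 ≠ p.2 ∧ distInt (x p.1 - x p.2) ≤ s / (N : ℝ) ^ β} =
      ∑ p : Fin N, (neighbors β x N (Set.Icc (-s) s) p).card := by
  classical
  rw [Set.ncard_eq_toFinset_card', Finset.card_eq_sum_card_fiberwise
    (f := fun i : Fin N × Fin N => i.1) (t := Finset.univ) (by intro i _; simp)]
  refine Finset.sum_congr rfl fun p _ => ?_
  symm
  have hN : 0 < (N : ℝ) ^ β := Real.rpow_pos_of_pos (by exact_mod_cast p.pos) _
  have key (t : ℝ) : (N : ℝ) ^ β * signedDistInt t ∈ Set.Icc (-s) s ↔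
      distInt t ≤ s / (N : ℝ) ^ β := by
    rw [Set.mem_Icc, ← abs_le, abs_mul, abs_of_pos hN, abs_signedDistInt, le_div_iff₀ hN, mul_comm]
  refine Finset.card_bij (fun q _ => (p, q)) ?_ ?_ ?_
  · intro q hq
    simp only [neighbors, Finset.mem_filter, Finset.mem_univ, true_and, key] at hq
    simpa using hq
  · intro q _ q' _ h
    simpa using h
  · rintro ⟨p', q⟩ hq
    simp only [Finset.mem_filter, Set.mem_toFinset, Set.mem_ofPred_eq] at hq
    obtain ⟨hq, rfl⟩ := hq
    exact ⟨q, by simpa [neighbors, key] using hq, rfl⟩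

/-- The average of a function on `Fin N`. -/
def avg {N : ℕ} (f : Fin N → ℝ) : ℝ := 1 / (N : ℝ) * ∑ p, f p

/-- With k = m + 1 the exponent k - (k-1)β is 1 + m(1-β): one factor N for the average and one
N^(1-β) for each further index. -/
theorem corr_eq_avg (m : ℕ) (β : ℝ) (x : ℕ → ℝ) (a b : Fin m → ℝ) {N : ℕ} (hN : 0 < N) :
    corr (m + 1) β x (Set.Icc a b) N =
      avg fun p : Fin N => (injCount fun j => neighbors β x N (Set.Icc (a j) (b j)) p : ℝ) /
        ((N : ℝ) ^ (1 - β)) ^ m := by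
  have hN' : (0 : ℝ) < N := by exact_mod_cast hN
  have := ncard_tuples_eq_sum m β x a b N
  unfold corr avg
  rw [← Finset.sum_div, ← Nat.cast_sum, ← this]
  have hpow : (N : ℝ) ^ (((m + 1 : ℕ) : ℝ) - (((m + 1 : ℕ) : ℝ) - 1) * β) =
      N * ((N : ℝ) ^ (1 - β)) ^ m := by
    nth_rewrite 2 [← Real.rpow_one (N : ℝ)]
    rw [← Real.rpow_natCast, ← Real.rpow_mul hN'.le, ← Real.rpow_add hN']
    congr 1
    push_cast
    ring
  rw [hpow]
  change _ * (Set.ncard {i : Fin (m + 1) → Fin N | _} : ℝ) = _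
  field_simp
  rfl

theorem pairCorr_eq_avg (β : ℝ) (x : ℕ → ℝ) (s : ℝ) {N : ℕ} (hN : 0 < N) :
    pairCorr β x s N =
      avg fun p : Fin N => ((neighbors β x N (Set.Icc (-s) s) p).card : ℝ) / (N : ℝ) ^ (1 - β) := by
  have hN' : (0 : ℝ) < N := by exact_mod_cast hN
  unfold pairCorr avg
  rw [ncard_pairs_eq_sum, ← Finset.sum_div]
  have hpow : (N : ℝ) ^ (2 - β) = N * (N : ℝ) ^ (1 - β) := by
    nth_rewrite 2 [← Real.rpow_one (N : ℝ)]
    rw [← Real.rpow_add hN']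
    congr 1
    ring
  rw [hpow]
  push_cast
  field_simp

/-! ### Averages and stability in Bernoulli's inequality -/

section Avg

variable {N : ℕ}

theorem avg_mono {f g : Fin N → ℝ} (h : ∀ p, f p ≤ g p) : avg f ≤ avg g :=
  mul_le_mul_of_nonneg_left (Finset.sum_le_sum fun p _ => h p) (by positivity)

theorem avg_add (f g : Fin N → ℝ) : avg (fun p => f p + g p) = avg f + avg g := by
  simp [avg, Finset.sum_add_distrib, mul_add]

theorem avg_sub (f g : Fin N → ℝ) : avg (fun p => f p - g p) = avg f - avg g := by
  simp [avg, Finset.sum_sub_distrib, mul_sub]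

theorem avg_const_mul (c : ℝ) (f : Fin N → ℝ) : avg (fun p => c * f p) = c * avg f := by
  simp only [avg, ← Finset.mul_sum]
  ring

theorem avg_const (hN : 0 < N) (c : ℝ) : avg (fun _ : Fin N => c) = c := by
  have : (N : ℝ) ≠ 0 := by positivity
  simp [avg, this]

theorem abs_avg_le (f : Fin N → ℝ) : |avg f| ≤ avg fun p => |f p| := by
  unfold avg
  rw [abs_mul, abs_of_nonneg (by positivity : (0 : ℝ) ≤ 1 / N)]
  exact mul_le_mul_of_nonneg_left (Finset.abs_sum_le_sum_abs _ _) (by positivity)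

end Avg

/-- The gap in Bernoulli's inequality. -/
def bernoulliGap (n : ℕ) (t : ℝ) : ℝ := t ^ n - 1 - n * (t - 1)

theorem bernoulliGap_succ (n : ℕ) (t : ℝ) :
    bernoulliGap (n + 1) t = t * bernoulliGap n t + n * (t - 1) ^ 2 := by
  unfold bernoulliGap
  push_cast
  ring

theorem bernoulliGap_nonneg (n : ℕ) {t : ℝ} (ht : 0 ≤ t) : 0 ≤ bernoulliGap n t := by
  induction n with
  | zero => simp [bernoulliGap]
  | succ n ih =>
    rw [bernoulliGap_succ]
    positivity

/-- In the recursion `bernoulliGap_succ` both summands are nonnegative. Keeping the first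
repeatedly, down to the gap (t-1)^2 for exponent 2, yields t^j (t-1)^2; keeping the second yields
(t-1)^2. -/
theorem mul_sq_le_bernoulliGap (j : ℕ) {t : ℝ} (ht : 0 ≤ t) :
    (t ^ j + 1) * (t - 1) ^ 2 ≤ 2 * bernoulliGap (j + 2) t := by
  have h1 : t ^ j * (t - 1) ^ 2 ≤ bernoulliGap (j + 2) t := by
    induction j with
    | zero =>
      simp only [bernoulliGap]
      push_cast
      nlinarith
    | succ j ih =>
      rw [bernoulliGap_succ]
      have := mul_le_mul_of_nonneg_left ih ht
      have h2 : 0 ≤ ((j + 2 : ℕ) : ℝ) * (t - 1) ^ 2 := by positivity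
      rw [pow_succ]
      linarith
  have h2 : (t - 1) ^ 2 ≤ bernoulliGap (j + 2) t := by
    rw [bernoulliGap_succ]
    have := mul_nonneg ht (bernoulliGap_nonneg (j + 1) ht)
    have h3 : 0 ≤ (j : ℝ) * (t - 1) ^ 2 := by positivity
    push_cast
    linarith
  linarith

/-- AM–GM splits (t+1)^(j+1) |t-1| into ε (t+1)^(j+2), controlled by the top moment, and ε⁻¹ (t+1)^j
(t-1)^2, controlled by the Bernoulli gap. -/
theorem abs_mul_sub_one_le (j : ℕ) {t u ε : ℝ} (ht : 0 ≤ t) (hu0 : 0 ≤ u)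
    (hu : u ≤ (t + 1) ^ (j + 1)) (hε : 0 < ε) :
    |u * t - u| ≤
      2 ^ (j + 1) * (ε * (t ^ (j + 2) + 1) + 2 * ε⁻¹ * bernoulliGap (j + 2) t) := by
  have h1 : (t + 1) * |t - 1| ≤ ε * (t + 1) ^ 2 + ε⁻¹ * (t - 1) ^ 2 := by
    have h : 0 ≤ ε⁻¹ * ((ε * (t + 1) - |t - 1|) ^ 2 + ε * (t + 1) * |t - 1|) := by positivity
    have h2 : ε⁻¹ * ((ε * (t + 1) - |t - 1|) ^ 2 + ε * (t + 1) * |t - 1|) =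
      ε * (t + 1) ^ 2 + ε⁻¹ * |t - 1| ^ 2 - (t + 1) * |t - 1| := by
      field_simp
      ring
    rw [h2, sq_abs] at h
    linarith
  have h2 : (t + 1) ^ (j + 2) ≤ 2 ^ (j + 1) * (t ^ (j + 2) + 1) := by
    simpa using add_pow_le ht zero_le_one (j + 2)
  have h3 : (t + 1) ^ j ≤ 2 ^ (j + 1) * (t ^ j + 1) := by
    have := add_pow_le ht zero_le_one j
    rw [one_pow] at this
    refine this.trans ?_
    gcongr
    · norm_num
    · omega
  have h4 := mul_sq_le_bernoulliGap j ht
  calc |u * t - u| = u * |t - 1| := by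
        rw [show u * t - u = u * (t - 1) by ring, abs_mul, abs_of_nonneg hu0]
    _ ≤ (t + 1) ^ (j + 1) * |t - 1| := by gcongr
    _ = (t + 1) ^ j * ((t + 1) * |t - 1|) := by ring
    _ ≤ (t + 1) ^ j * (ε * (t + 1) ^ 2 + ε⁻¹ * (t - 1) ^ 2) := by gcongr
    _ = ε * (t + 1) ^ (j + 2) + ε⁻¹ * ((t + 1) ^ j * (t - 1) ^ 2) := by ring
    _ ≤ ε * (2 ^ (j + 1) * (t ^ (j + 2) + 1)) +
        ε⁻¹ * (2 ^ (j + 1) * (t ^ j + 1) * (t - 1) ^ 2) := by gcongr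
    _ = 2 ^ (j + 1) * (ε * (t ^ (j + 2) + 1) + ε⁻¹ * ((t ^ j + 1) * (t - 1) ^ 2)) := by ring
    _ ≤ 2 ^ (j + 1) * (ε * (t ^ (j + 2) + 1) + ε⁻¹ * (2 * bernoulliGap (j + 2) t)) := by gcongr
    _ = _ := by ring

theorem avg_bernoulliGap {N : ℕ} (hN : 0 < N) (n : ℕ) (H : Fin N → ℝ) :
    avg (fun p => bernoulliGap n (H p)) = avg (fun p => H p ^ n) - 1 - n * (avg H - 1) := by
  unfold bernoulliGap
  rw [avg_sub, avg_sub, avg_const hN, avg_const_mul, avg_sub, avg_const hN]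

/-- A weight whose first and `(j + 2)`-nd moments tend to `1` may be removed from an average. -/
theorem tendsto_avg_of_tendsto_avg_mul (j : ℕ) (H U : ∀ N, Fin N → ℝ) (e : ℕ → ℝ) (v : ℝ)
    (hH0 : ∀ N p, 0 ≤ H N p) (hU0 : ∀ N p, 0 ≤ U N p)
    (hU : ∀ᶠ N in atTop, ∀ p, U N p ≤ (H N p + 1) ^ (j + 1))
    (hH : Tendsto (fun N => avg (H N)) atTop (𝓝 1))
    (hpow : ∀ᶠ N in atTop, avg (fun p => H N p ^ (j + 2)) ≤ e N)
    (he : Tendsto e atTop (𝓝 1))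
    (hUH : Tendsto (fun N => avg fun p => U N p * H N p) atTop (𝓝 v)) :
    Tendsto (fun N => avg (U N)) atTop (𝓝 v) := by
  suffices h : Tendsto (fun N => avg (fun p => U N p * H N p) - avg (U N)) atTop (𝓝 0) by
    simpa using hUH.sub h
  rw [Metric.tendsto_nhds]
  intro η hη
  -- The bound below tends to 2^(j+1) * 2ε, which this choice makes η / 2.
  set ε : ℝ := η / 2 ^ (j + 3) with hεdef
  have hε : 0 < ε := by positivity
  have hlim : Tendsto (fun N => (2 : ℝ) ^ (j + 1) *
      (ε * (e N + 1) + 2 * ε⁻¹ * (e N - 1 - ((j + 2 : ℕ) : ℝ) * (avg (H N) - 1)))) atTop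
      (𝓝 (2 ^ (j + 1) * (ε * (1 + 1) + 2 * ε⁻¹ * (1 - 1 - ((j + 2 : ℕ) : ℝ) * (1 - 1))))) := by
    refine Tendsto.const_mul _ (((he.add_const _).const_mul _).add (Tendsto.const_mul _ ?_))
    exact (he.sub_const _).sub ((hH.sub_const _).const_mul _)
  have hlt : (2 : ℝ) ^ (j + 1) *
      (ε * (1 + 1) + 2 * ε⁻¹ * (1 - 1 - ((j + 2 : ℕ) : ℝ) * (1 - 1))) < η := by
    have : (2 : ℝ) ^ (j + 1) *
      (ε * (1 + 1) + 2 * ε⁻¹ * (1 - 1 - ((j + 2 : ℕ) : ℝ) * (1 - 1))) = η / 2 := by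
      rw [hεdef]
      simp only [sub_self, mul_zero, add_zero]
      field_simp
      ring
    rw [this]
    linarith
  filter_upwards [hlim.eventually_lt_const hlt, hU, hpow, eventually_gt_atTop 0] with N h1 h2 h3 hN
  rw [Real.dist_eq, sub_zero, ← avg_sub]
  refine lt_of_le_of_lt ((abs_avg_le _).trans ((avg_mono fun p =>
    abs_mul_sub_one_le j (hH0 N p) (hU0 N p) (h2 p) hε).trans ?_)) h1
  rw [avg_const_mul, avg_add, avg_const_mul, avg_add, avg_const hN, avg_const_mul,
    avg_bernoulliGap hN]
  gcongr

/-! ### Neighbour counts and the passage from k to k - 1 -/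

/-- The normalized number of neighbours in excess of `m`. -/
def excess (β : ℝ) (x : ℕ → ℝ) (s : ℝ) (m N : ℕ) (p : Fin N) : ℝ :=
  (((neighbors β x N (Set.Icc (-s) s) p).card - m : ℕ) : ℝ) / (2 * s * (N : ℝ) ^ (1 - β))

theorem excess_nonneg (β : ℝ) (x : ℕ → ℝ) {s : ℝ} (hs : 0 < s) (m N : ℕ) (p : Fin N) :
    0 ≤ excess β x s m N p := by
  unfold excess
  positivity

theorem card_le_excess (β : ℝ) (x : ℕ → ℝ) {s : ℝ} (hs : 0 < s) (m N : ℕ) (p : Fin N) :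
    ((neighbors β x N (Set.Icc (-s) s) p).card : ℝ) / (2 * s * (N : ℝ) ^ (1 - β)) ≤
      excess β x s m N p + m / (2 * s * (N : ℝ) ^ (1 - β)) := by
  unfold excess
  rw [← add_div]
  gcongr
  exact_mod_cast (by omega)

theorem excess_le_card (β : ℝ) (x : ℕ → ℝ) {s : ℝ} (hs : 0 < s) (m N : ℕ) (p : Fin N) :
    excess β x s m N p ≤
      ((neighbors β x N (Set.Icc (-s) s) p).card : ℝ) / (2 * s * (N : ℝ) ^ (1 - β)) := by
  unfold excess
  gcongr
  exact_mod_cast (by omega)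

/-- Each of the m + 1 factors of the falling factorial n(n-1)⋯(n-m) is at least n - m. -/
theorem avg_excess_pow_le (β : ℝ) (x : ℕ → ℝ) {s : ℝ} (hs : 0 < s) (m : ℕ) {N : ℕ} (hN : 0 < N) :
    avg (fun p => excess β x s m N p ^ (m + 1)) ≤
      corr (m + 2) β x (Set.Icc (fun _ => -s) (fun _ => s)) N / (2 * s) ^ (m + 1) := by
  have h := corr_eq_avg (m + 1) β x (fun _ => -s) (fun _ => s) hN
  rw [show corr (m + 2) β x (Set.Icc (fun _ => -s) fun _ => s) N = _ from h, div_eq_inv_mul,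
    ← avg_const_mul]
  refine avg_mono fun p => ?_
  rw [injCount_const]
  unfold excess
  rw [div_pow, mul_pow, ← div_div, div_eq_inv_mul _ ((2 * s) ^ (m + 1)), mul_div_assoc]
  gcongr
  have := Nat.pow_sub_le_descFactorial (neighbors β x N (Set.Icc (-s) s) p).card (m + 1)
  rw [Nat.add_sub_add_right] at this
  exact_mod_cast this

/-- Here β < 1 enters: the expected number of neighbours is unbounded, so the corrections for
distinctness of indices vanish. -/
theorem tendsto_div_mul_rpow {β : ℝ} (hβ : β < 1) {s : ℝ} (hs : 0 < s) (c : ℝ) :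
    Tendsto (fun N : ℕ => c / (2 * s * (N : ℝ) ^ (1 - β))) atTop (𝓝 0) := by
  refine Tendsto.const_div_atTop (Tendsto.const_mul_atTop (by positivity) ?_) _
  exact (tendsto_rpow_atTop (by linarith)).comp tendsto_natCast_atTop_atTop

theorem tendsto_corr_cube {β : ℝ} {x : ℕ → ℝ} {m : ℕ} (h : HasPoissonianCorr (m + 2) β x) {s : ℝ}
    (hs : 0 < s) (hs' : β = 0 → s ≤ 1 / 2) :
    Tendsto (fun N => corr (m + 2) β x (Set.Icc (fun _ => -s) (fun _ => s)) N /
      (2 * s) ^ (m + 1)) atTop (𝓝 1) := by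
  have h1 := h (fun _ => -s) (fun _ => s) (fun _ => by linarith) fun h0 =>
    Set.Icc_subset_Icc (fun _ => by have := hs' h0; linarith) (fun _ => hs' h0)
  rw [Measure.real, Real.volume_Icc_pi_toReal (fun _ => by linarith)] at h1
  have h2 := h1.div_const ((2 * s) ^ (m + 1))
  have h3 : (∏ _i : Fin (m + 2 - 1), (s - -s)) / (2 * s) ^ (m + 1) = 1 := by
    rw [Finset.prod_const, Finset.card_univ, Fintype.card_fin]
    rw [show s - -s = 2 * s by ring, show m + 2 - 1 = m + 1 by omega]
    exact div_self (by positivity)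
  rwa [h3] at h2

theorem pairCorr_eq_avg_card (β : ℝ) (x : ℕ → ℝ) {s : ℝ} (hs : 0 < s) {N : ℕ} (hN : 0 < N) :
    pairCorr β x s N = 2 * s * avg fun p : Fin N =>
      ((neighbors β x N (Set.Icc (-s) s) p).card : ℝ) / (2 * s * (N : ℝ) ^ (1 - β)) := by
  rw [pairCorr_eq_avg β x s hN, ← avg_const_mul]
  congr 1
  ext p
  field_simp

/-- Poissonian correlations bound the pair correlations from above. -/
theorem eventually_pairCorr_lt {β : ℝ} (hβ : β < 1) {x : ℕ → ℝ} {m : ℕ}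
    (h : HasPoissonianCorr (m + 2) β x) {s : ℝ} (hs : 0 < s) (hs' : β = 0 → s ≤ 1 / 2)
    {c : ℝ} (hc : 2 * s < c) : ∀ᶠ N in atTop, pairCorr β x s N < c := by
  set e := fun N => corr (m + 2) β x (Set.Icc (fun _ => -s) (fun _ => s)) N / (2 * s) ^ (m + 1)
  have hlim : Tendsto (fun N : ℕ => 2 * s * (1 + (e N - 1) / ((m + 1 : ℕ) : ℝ) +
      m / (2 * s * (N : ℝ) ^ (1 - β)))) atTop
      (𝓝 (2 * s * (1 + (1 - 1) / ((m + 1 : ℕ) : ℝ) + 0))) := by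
    refine Tendsto.const_mul _ (Tendsto.add (Tendsto.const_add _ (Tendsto.div_const ?_ _))
      (tendsto_div_mul_rpow hβ hs _))
    exact (tendsto_corr_cube h hs hs').sub_const 1
  filter_upwards [hlim.eventually_lt_const (u := c) (by simpa using hc), eventually_gt_atTop 0]
    with N h1 hN
  refine lt_of_le_of_lt ?_ h1
  rw [pairCorr_eq_avg_card β x hs hN]
  refine mul_le_mul_of_nonneg_left ?_ (by positivity)
  refine (avg_mono fun p => card_le_excess β x hs m N p).trans ?_
  rw [avg_add, avg_const hN]
  gcongr
  -- Averaging Bernoulli's inequality: (m+1)(mean of H - 1) is at most the mean of H^(m+1) minus 1.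
  have h2 : 0 ≤ avg fun p => bernoulliGap (m + 1) (excess β x s m N p) := by
    rw [← avg_const hN 0]
    exact avg_mono fun p => bernoulliGap_nonneg _ (excess_nonneg β x hs m N p)
  rw [avg_bernoulliGap hN] at h2
  have h3 := avg_excess_pow_le β x hs m hN
  have hm : (0 : ℝ) < ((m + 1 : ℕ) : ℝ) := by positivity
  have h4 : (avg fun p => excess β x s m N p) - 1 ≤ (e N - 1) / ((m + 1 : ℕ) : ℝ) := by
    rw [le_div_iff₀ hm]
    linarith
  linarith

theorem tendsto_avg_excess {β : ℝ} (hβ : β < 1) {x : ℕ → ℝ} (h : HasPPC β x) {s : ℝ}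
    (hs : 0 < s) (hs' : β = 0 → s ≤ 1 / 2) (m : ℕ) :
    Tendsto (fun N => avg (excess β x s m N)) atTop (𝓝 1) := by
  have h1 : Tendsto (fun N => pairCorr β x s N / (2 * s)) atTop (𝓝 1) := by
    have := (h s hs hs').div_const (2 * s)
    rwa [div_self (by positivity)] at this
  have h2 : Tendsto (fun N : ℕ => pairCorr β x s N / (2 * s) -
      m / (2 * s * (N : ℝ) ^ (1 - β))) atTop (𝓝 1) := by
    simpa using h1.sub (tendsto_div_mul_rpow hβ hs m)
  have key : ∀ {N : ℕ}, 0 < N → pairCorr β x s N / (2 * s) = avg fun p : Fin N =>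
      ((neighbors β x N (Set.Icc (-s) s) p).card : ℝ) / (2 * s * (N : ℝ) ^ (1 - β)) := by
    intro N hN
    rw [pairCorr_eq_avg_card β x hs hN]
    field_simp
  refine tendsto_of_tendsto_of_tendsto_of_le_of_le' h2 h1 ?_ ?_
  · filter_upwards [eventually_gt_atTop 0] with N hN
    rw [key hN, sub_le_iff_le_add]
    refine (avg_mono fun p => card_le_excess β x hs m N p).trans ?_
    rw [avg_add, avg_const hN]
  · filter_upwards [eventually_gt_atTop 0] with N hN
    rw [key hN]
    exact avg_mono fun p => excess_le_card β x hs m N p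

/-- With U the normalized count of tuples in the given rectangle, the hypothesis applied to the
rectangle enlarged by [-T, T] gives the limit of the mean of U * H. Concentration of H at 1 then
gives that of U. -/
theorem HasPoissonianCorr.pred {β : ℝ} (hβ : β < 1) {x : ℕ → ℝ} {j : ℕ}
    (h : HasPoissonianCorr (j + 3) β x) (hP : HasPPC β x) : HasPoissonianCorr (j + 2) β x := by
  intro a b hab hR
  change Fin (j + 1) → ℝ at a b
  -- For β = 0 the enlarged rectangle must stay admissible, so T = 1/2; otherwise any large T
  -- serves, the summand 1 making it positive.
  obtain ⟨T, hT, hT', haT, hbT⟩ : ∃ T : ℝ, 0 < T ∧ (β = 0 → T ≤ 1 / 2) ∧ (∀ i, -T ≤ a i) ∧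
      ∀ i, b i ≤ T := by
    by_cases h0 : β = 0
    · refine ⟨1 / 2, by norm_num, fun _ => le_rfl, ?_, ?_⟩
      · exact fun i => ((hR h0) (Set.left_mem_Icc.2 hab)).1 i
      · exact fun i => ((hR h0) (Set.right_mem_Icc.2 hab)).2 i
    · refine ⟨1 + ∑ i, (|a i| + |b i|), by positivity, fun h => absurd h h0, fun i => ?_,
        fun i => ?_⟩
      all_goals
        have h1 := Finset.single_le_sum (f := fun i => |a i| + |b i|) (fun i _ => by positivity)
          (Finset.mem_univ i)
        have h2 := neg_abs_le (a i)
        have h3 := le_abs_self (b i)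
        have h4 := abs_nonneg (a i)
        have h5 := abs_nonneg (b i)
        linarith
  set B : ∀ N, Fin N → Fin (j + 1) → Finset (Fin N) := fun N p i =>
    neighbors β x N (Set.Icc (a i) (b i)) p
  have hBsub : ∀ N p i, B N p i ⊆ neighbors β x N (Set.Icc (-T) T) p := fun N p i =>
    neighbors_mono β x N (Set.Icc_subset_Icc (haT i) (hbT i)) p
  set U : ∀ N, Fin N → ℝ := fun N p =>
    (injCount (B N p) : ℝ) / (2 * T * (N : ℝ) ^ (1 - β)) ^ (j + 1)
  have hlim : Tendsto (fun N => avg (U N)) atTop (𝓝 ((∏ i, (b i - a i)) / (2 * T) ^ (j + 1))) := by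
    refine tendsto_avg_of_tendsto_avg_mul j (excess β x T (j + 1)) U
      (fun N => corr (j + 3) β x (Set.Icc (fun _ => -T) (fun _ => T)) N / (2 * T) ^ (j + 2)) _
      (fun N p => excess_nonneg β x hT _ N p) (fun N p => by positivity) ?_
      (tendsto_avg_excess hβ hP hT hT' _) ?_ (tendsto_corr_cube h hT hT') ?_
    -- For large N the shift (j+1) / (2T N^(1-β)) is at most 1, which is the 1 in the majorant
    -- (H+1)^(j+1).
    · filter_upwards [(tendsto_div_mul_rpow hβ hT ((j + 1 : ℕ) : ℝ)).eventually_le_const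
        zero_lt_one] with N hN p
      calc U N p ≤ (((neighbors β x N (Set.Icc (-T) T) p).card : ℝ) /
              (2 * T * (N : ℝ) ^ (1 - β))) ^ (j + 1) := by
            rw [div_pow]
            simp only [U]
            gcongr
            exact_mod_cast injCount_le_pow _ _ (hBsub N p)
        _ ≤ (excess β x T (j + 1) N p + 1) ^ (j + 1) := by
            gcongr
            exact (card_le_excess β x hT (j + 1) N p).trans (by gcongr)
    · filter_upwards [eventually_gt_atTop 0] with N hN
      exact avg_excess_pow_le β x hT (j + 1) hN
    · have h1 := h (Fin.cons (-T) a : Fin (j + 2) → ℝ) (Fin.cons T b : Fin (j + 2) → ℝ)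
        (by
          intro i
          refine Fin.cases ?_ (fun i => ?_) i
          · simp only [Fin.cons_zero]
            linarith
          · simpa using hab i)
        (by
          intro h0
          refine Set.Icc_subset_Icc (fun i => ?_) (fun i => ?_)
          · refine Fin.cases ?_ (fun i => ?_) i
            · simpa using hT' h0
            · simpa using ((hR h0) (Set.left_mem_Icc.2 hab)).1 i
          · refine Fin.cases ?_ (fun i => ?_) i
            · simpa using hT' h0
            · simpa using ((hR h0) (Set.right_mem_Icc.2 hab)).2 i)
      have hvol : (volume : Measure (Fin (j + 3 - 1) → ℝ)).real
          (Set.Icc (Fin.cons (-T) a : Fin (j + 2) → ℝ) (Fin.cons T b : Fin (j + 2) → ℝ)) =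
          2 * T * ∏ i, (b i - a i) := by
        change (volume : Measure (Fin (j + 2) → ℝ)).real _ = _
        rw [Measure.real, Real.volume_Icc_pi_toReal, Fin.prod_univ_succ]
        · simp only [Fin.cons_zero, Fin.cons_succ]
          ring
        · intro i
          refine Fin.cases ?_ (fun i => ?_) i
          · simp only [Fin.cons_zero]
            linarith
          · simpa using hab i
      rw [hvol] at h1
      have h2 := h1.div_const ((2 * T) ^ (j + 2))
      rw [pow_succ' (2 * T) (j + 1), mul_div_mul_left _ _ (by positivity)] at h2
      refine h2.congr' ?_
      filter_upwards [eventually_gt_atTop 0] with N hN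
      have h4 := corr_eq_avg (j + 2) β x (Fin.cons (-T) a) (Fin.cons T b) hN
      rw [h4, div_eq_inv_mul, ← avg_const_mul]
      congr 1
      ext p
      have h5 : (fun i : Fin (j + 2) => neighbors β x N (Set.Icc
          ((Fin.cons (-T) a : Fin (j + 2) → ℝ) i) ((Fin.cons T b : Fin (j + 2) → ℝ) i)) p) =
          Fin.cons (neighbors β x N (Set.Icc (-T) T) p) (B N p) := by
        ext i : 1
        refine Fin.cases ?_ (fun i => ?_) i <;> simp [B]
      rw [h5, injCount_cons _ _ (hBsub N p)]
      simp only [U, excess]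
      push_cast
      have hNpos : (0 : ℝ) < (N : ℝ) ^ (1 - β) := Real.rpow_pos_of_pos (by exact_mod_cast hN) _
      field_simp
      ring
  have h1 := hlim.const_mul ((2 * T) ^ (j + 1))
  have hvol : (volume : Measure (Fin (j + 2 - 1) → ℝ)).real (Set.Icc a b) =
      (2 * T) ^ (j + 1) * ((∏ i, (b i - a i)) / (2 * T) ^ (j + 1)) := by
    change (volume : Measure (Fin (j + 1) → ℝ)).real _ = _
    rw [Measure.real, Real.volume_Icc_pi_toReal hab]
    field_simp
  rw [hvol]
  refine h1.congr' ?_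
  filter_upwards [eventually_gt_atTop 0] with N hN
  have h4 := corr_eq_avg (j + 1) β x a b hN
  rw [h4, ← avg_const_mul]
  congr 1
  ext p
  simp only [U, B]
  have hNpos : (0 : ℝ) < (N : ℝ) ^ (1 - β) := Real.rpow_pos_of_pos (by exact_mod_cast hN) _
  rw [mul_pow _ ((N : ℝ) ^ (1 - β))]
  field_simp

/-! ### Arcs modulo 1, tents and second moments -/

/-- The indicator function of the arc `[0, w)` modulo `1`. -/
def arcInd (w u : ℝ) : ℝ := if Int.fract u < w then 1 else 0

theorem arcInd_nonneg (w u : ℝ) : 0 ≤ arcInd w u := by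
  unfold arcInd
  split_ifs <;> norm_num

theorem arcInd_le_one (w u : ℝ) : arcInd w u ≤ 1 := by
  unfold arcInd
  split_ifs <;> norm_num

theorem measurable_arcInd (w : ℝ) : Measurable (arcInd w) :=
  Measurable.ite (measurableSet_lt measurable_fract measurable_const) measurable_const
    measurable_const

theorem arcInd_periodic (w : ℝ) : Function.Periodic (arcInd w) 1 := fun u => by
  simp [arcInd, Int.fract_add_one]

/-- The arc is cut into q adjacent translates; total length at most 1 prevents overlap after
wrapping around. -/
theorem arcInd_natCast_mul {w : ℝ} (hw : 0 ≤ w) (q : ℕ) (hq : q * w ≤ 1) (u : ℝ) :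
    arcInd (q * w) u = ∑ j ∈ Finset.range q, arcInd w (u - j * w) := by
  induction q with
  | zero => simp [arcInd, Int.fract_nonneg]
  | succ q ih =>
    push_cast at hq ⊢
    have hqw : 0 ≤ q * w := by positivity
    rw [Finset.sum_range_succ, ← ih (by linarith)]
    have h0 := Int.fract_nonneg u
    have h1 := Int.fract_lt_one u
    have hf : Int.fract (u - q * w) = Int.fract (Int.fract u - q * w) := by
      rw [← Int.self_sub_floor u, show u - ⌊u⌋ - q * w = u - q * w - ⌊u⌋ by ring,
        Int.fract_sub_intCast]
    unfold arcInd
    rw [hf]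
    rcases le_or_gt (q * w) (Int.fract u) with h | h
    · have h2 : Int.fract (Int.fract u - q * w) = Int.fract u - q * w :=
        Int.fract_eq_self.2 ⟨by linarith, by linarith⟩
      rw [h2, if_neg (not_lt.2 h), zero_add]
      congr 1
      rw [sub_lt_iff_lt_add', add_mul, one_mul]
    · have h2 : Int.fract (Int.fract u - q * w) = Int.fract u - q * w + 1 := by
        rw [← Int.fract_add_one, Int.fract_eq_self.2 ⟨by linarith, by linarith⟩]
      rw [h2, if_pos h, if_pos (by linarith), if_neg (by linarith), add_zero]

theorem intervalIntegrable_of_bounded {f : ℝ → ℝ} (hf : Measurable f) (C : ℝ)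
    (hC : ∀ t, |f t| ≤ C) (a b : ℝ) : IntervalIntegrable f volume a b := by
  refine (intervalIntegrable_const (c := C)).mono_fun hf.aestronglyMeasurable ?_
  exact ae_of_all _ fun t => by
    exact (hC t).trans (le_abs_self C)

theorem fract_add_signedDistInt (u t : ℝ) :
    Int.fract (u + signedDistInt t) = Int.fract (u + t) := by
  rw [Int.fract_eq_fract]
  unfold signedDistInt
  split_ifs
  · exact ⟨-⌊t⌋, by rw [← Int.self_sub_floor]; push_cast; ring⟩
  · exact ⟨-⌊t⌋ - 1, by rw [← Int.self_sub_floor]; push_cast; ring⟩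

theorem signedDistInt_bounds (t : ℝ) : -(1 / 2) < signedDistInt t ∧ signedDistInt t ≤ 1 / 2 := by
  have h0 := Int.fract_nonneg t
  have h1 := Int.fract_lt_one t
  unfold signedDistInt
  split_ifs <;> constructor <;> linarith

/-- The overlap of two arcs of length w is a tent in their displacement δ; since w ≤ 1/2 they cannot
meet on both sides of the circle. -/
theorem integral_arcInd_mul (x y : ℝ) {w : ℝ} (hw2 : w ≤ 1 / 2) :
    ∫ t in (0 : ℝ)..1, arcInd w (x - t) * arcInd w (y - t) = max (w - distInt (y - x)) 0 := by
  set δ := signedDistInt (y - x) with hδ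
  obtain ⟨hδ1, hδ2⟩ := signedDistInt_bounds (y - x)
  rw [← hδ] at hδ1 hδ2
  set f : ℝ → ℝ := fun u => arcInd w u * arcInd w (u + δ)
  have hper : Function.Periodic f 1 := fun u => by
    simp only [f]
    rw [add_right_comm, arcInd_periodic, arcInd_periodic]
  have h1 : ∀ t, arcInd w (x - t) * arcInd w (y - t) = f (x - t) := fun t => by
    simp only [f, arcInd, hδ, fract_add_signedDistInt]
    rw [show x - t + (y - x) = y - t by ring]
  simp_rw [h1]
  rw [intervalIntegral.integral_comp_sub_left f x]
  have h2 := hper.intervalIntegral_add_eq (x - 1) 0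
  rw [sub_add_cancel, zero_add] at h2
  rw [sub_zero, h2, intervalIntegral.integral_of_le zero_le_one, ← integral_Ico_eq_integral_Ioc]
  have h3 : ∀ u ∈ Set.Ico (0 : ℝ) 1,
      f u = (Set.Ico (max 0 (-δ)) (w - max 0 δ)).indicator (fun _ => (1 : ℝ)) u := by
    rintro u ⟨hu0, hu1⟩
    have hfu : Int.fract u = u := Int.fract_eq_self.2 ⟨hu0, hu1⟩
    simp only [f, arcInd, hfu, Set.indicator_apply, Set.mem_Ico]
    by_cases huw : u < w
    · rcases le_or_gt 0 (u + δ) with h | h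
      · have : Int.fract (u + δ) = u + δ := Int.fract_eq_self.2 ⟨h, by linarith⟩
        rw [this, if_pos huw, one_mul]
        congr 1
        rw [max_le_iff, lt_sub_iff_add_lt, eq_iff_iff]
        constructor
        · intro h'
          refine ⟨⟨hu0, by linarith⟩, ?_⟩
          rcases max_cases 0 δ with hm | hm <;> linarith
        · rintro ⟨-, h'⟩
          have := le_max_right 0 δ
          linarith
      -- Wrapped case: u + δ + 1 > 1/2 ≥ w because δ > -1/2, so the second factor vanishes.
      · have : Int.fract (u + δ) = u + δ + 1 := by
          rw [← Int.fract_add_one, Int.fract_eq_self.2 ⟨by linarith, by linarith⟩]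
        rw [this, if_neg (show ¬u + δ + 1 < w by linarith), mul_zero, if_neg]
        rintro ⟨h', -⟩
        have := (le_max_right 0 (-δ)).trans h'
        linarith
    · rw [if_neg huw, zero_mul, if_neg]
      rintro ⟨-, h'⟩
      have := le_max_left 0 δ
      linarith
  rw [setIntegral_congr_fun measurableSet_Ico h3, setIntegral_indicator measurableSet_Ico,
    setIntegral_const, smul_eq_mul, mul_one, Set.inter_eq_right.2, Real.volume_real_Ico,
    ← abs_signedDistInt, ← hδ]
  · congr 1
    rcases le_total 0 δ with h | h
    · rw [max_eq_right h, max_eq_left (by linarith), abs_of_nonneg h, sub_zero]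
    · rw [max_eq_left h, max_eq_right (by linarith), abs_of_nonpos h, sub_zero]
  · refine Set.Ico_subset_Ico (le_max_left _ _) ?_
    have := le_max_left 0 δ
    linarith

theorem distInt_nonneg (t : ℝ) : 0 ≤ distInt t := abs_nonneg _

theorem distInt_zero : distInt 0 = 0 := by simp [distInt]

theorem integral_arcInd (x : ℝ) {w : ℝ} (hw : 0 ≤ w) (hw2 : w ≤ 1 / 2) :
    ∫ t in (0 : ℝ)..1, arcInd w (x - t) = w := by
  have h := integral_arcInd_mul x x hw2
  rw [sub_self, distInt_zero, sub_zero, max_eq_left hw] at h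
  refine Eq.trans ?_ h
  congr 1
  ext t
  unfold arcInd
  split_ifs <;> norm_num

/-- The number of the first `N` terms of `x` in the arc `[t, t + w)` modulo `1`. -/
def arcCount (x : ℕ → ℝ) (w : ℝ) (N : ℕ) (t : ℝ) : ℝ := ∑ i : Fin N, arcInd w (x i - t)

/-- The pair sum of the tent function of width `w`. -/
def tentSum (x : ℕ → ℝ) (w : ℝ) (N : ℕ) : ℝ :=
  ∑ i : Fin N, ∑ j : Fin N, max (w - distInt (x i - x j)) 0

theorem measurable_arcCount (x : ℕ → ℝ) (w : ℝ) (N : ℕ) : Measurable (arcCount x w N) :=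
  Finset.measurable_fun_sum _ fun _ _ =>
    (measurable_arcInd w).comp (measurable_id.const_sub _)

theorem arcCount_nonneg (x : ℕ → ℝ) (w : ℝ) (N : ℕ) (t : ℝ) : 0 ≤ arcCount x w N t :=
  Finset.sum_nonneg fun _ _ => arcInd_nonneg _ _

theorem arcCount_le (x : ℕ → ℝ) (w : ℝ) (N : ℕ) (t : ℝ) : arcCount x w N t ≤ N := by
  refine (Finset.sum_le_sum fun _ _ => arcInd_le_one _ _).trans ?_
  simp

theorem arcCount_periodic (x : ℕ → ℝ) (w : ℝ) (N : ℕ) :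
    Function.Periodic (arcCount x w N) 1 := fun t => by
  unfold arcCount
  refine Finset.sum_congr rfl fun i _ => ?_
  rw [← sub_sub, (arcInd_periodic w).sub_eq]

theorem intervalIntegrable_arcInd (w x a b : ℝ) :
    IntervalIntegrable (fun t => arcInd w (x - t)) volume a b := by
  refine intervalIntegrable_of_bounded
    ((measurable_arcInd w).comp (measurable_id.const_sub _)) 1 (fun t => ?_) a b
  change |arcInd w (x - t)| ≤ 1
  rw [abs_of_nonneg (arcInd_nonneg _ _)]
  exact arcInd_le_one _ _

theorem intervalIntegrable_arcCount (x : ℕ → ℝ) (w : ℝ) (N : ℕ) (a b : ℝ) :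
    IntervalIntegrable (arcCount x w N) volume a b := by
  refine intervalIntegrable_of_bounded (measurable_arcCount x w N) N (fun t => ?_) a b
  rw [abs_of_nonneg (arcCount_nonneg _ _ _ _)]
  exact arcCount_le _ _ _ _

theorem intervalIntegrable_arcCount_sq (x : ℕ → ℝ) (w : ℝ) (N : ℕ) (a b : ℝ) :
    IntervalIntegrable (fun t => arcCount x w N t ^ 2) volume a b := by
  refine intervalIntegrable_of_bounded ((measurable_arcCount x w N).pow_const 2) ((N : ℝ) ^ 2)
    (fun t => ?_) a b
  rw [abs_of_nonneg (by positivity)]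
  exact pow_le_pow_left₀ (arcCount_nonneg _ _ _ _) (arcCount_le _ _ _ _) 2

theorem integral_arcCount (x : ℕ → ℝ) {w : ℝ} (hw : 0 ≤ w) (hw2 : w ≤ 1 / 2) (N : ℕ) :
    ∫ t in (0 : ℝ)..1, arcCount x w N t = w * N := by
  unfold arcCount
  rw [intervalIntegral.integral_finsetSum fun (i : Fin N) _ =>
    intervalIntegrable_arcInd w (x i) 0 1]
  simp_rw [integral_arcInd _ hw hw2]
  simp [mul_comm]

theorem integral_arcCount_sq (x : ℕ → ℝ) {w : ℝ} (hw2 : w ≤ 1 / 2) (N : ℕ) :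
    ∫ t in (0 : ℝ)..1, arcCount x w N t ^ 2 = tentSum x w N := by
  have hint : ∀ i j : Fin N, IntervalIntegrable (fun t => arcInd w (x j - t) * arcInd w (x i - t))
      volume 0 1 := fun i j => by
    refine intervalIntegrable_of_bounded
      (((measurable_arcInd w).comp (measurable_id.const_sub _)).mul
        ((measurable_arcInd w).comp (measurable_id.const_sub _))) 1 (fun t => ?_) 0 1
    change |arcInd w (x j - t) * arcInd w (x i - t)| ≤ 1
    rw [abs_of_nonneg (mul_nonneg (arcInd_nonneg _ _) (arcInd_nonneg _ _))]
    exact mul_le_one₀ (arcInd_le_one _ _) (arcInd_nonneg _ _) (arcInd_le_one _ _)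
  unfold arcCount tentSum
  have h : ∀ t, (∑ i : Fin N, arcInd w (x i - t)) ^ 2 =
      ∑ i : Fin N, ∑ j : Fin N, arcInd w (x j - t) * arcInd w (x i - t) := fun t => by
    rw [sq, Finset.sum_mul_sum]
    exact Finset.sum_congr rfl fun i _ => Finset.sum_congr rfl fun j _ => mul_comm _ _
  simp_rw [h]
  rw [intervalIntegral.integral_finsetSum fun i _ =>
    by simpa only [Finset.sum_fn] using IntervalIntegrable.sum Finset.univ fun j _ => hint i j]
  refine Finset.sum_congr rfl fun i _ => ?_
  rw [intervalIntegral.integral_finsetSum fun j _ => hint i j]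
  exact Finset.sum_congr rfl fun j _ => integral_arcInd_mul _ _ hw2

theorem integral_arcCount_variance (x : ℕ → ℝ) {w : ℝ} (hw : 0 ≤ w) (hw2 : w ≤ 1 / 2) (N : ℕ) :
    ∫ t in (0 : ℝ)..1, (arcCount x w N t - w * N) ^ 2 = tentSum x w N - (w * N) ^ 2 := by
  have h : ∀ t, (arcCount x w N t - w * N) ^ 2 =
      arcCount x w N t ^ 2 - 2 * (w * N) * arcCount x w N t + (w * N) ^ 2 := fun t => by ring
  simp_rw [h]
  rw [intervalIntegral.integral_add
    ((intervalIntegrable_arcCount_sq x w N 0 1).sub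
      ((intervalIntegrable_arcCount x w N 0 1).const_mul _)) intervalIntegrable_const,
    intervalIntegral.integral_sub (intervalIntegrable_arcCount_sq x w N 0 1)
      ((intervalIntegrable_arcCount x w N 0 1).const_mul _),
    intervalIntegral.integral_const_mul, integral_arcCount x hw hw2, integral_arcCount_sq x hw2,
    intervalIntegral.integral_const]
  simp only [sub_zero, smul_eq_mul, one_mul]
  ring

/-- Nonnegativity of the variance. It holds for every point set and is the source of all lower
bounds. -/
theorem sq_le_tentSum (x : ℕ → ℝ) {w : ℝ} (hw : 0 ≤ w) (hw2 : w ≤ 1 / 2) (N : ℕ) :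
    (w * N) ^ 2 ≤ tentSum x w N := by
  rw [← sub_nonneg, ← integral_arcCount_variance x hw hw2]
  exact intervalIntegral.integral_nonneg zero_le_one fun t _ => sq_nonneg _

theorem tentSum_mono (x : ℕ → ℝ) {w w' : ℝ} (h : w ≤ w') (N : ℕ) :
    tentSum x w N ≤ tentSum x w' N :=
  Finset.sum_le_sum fun _ _ => Finset.sum_le_sum fun _ _ => by gcongr

/-- The count in the long arc is a sum of q shifted short-arc counts. Cauchy–Schwarz bounds its
square, and all shifts have the same second moment by periodicity. -/
theorem tentSum_natCast_mul_le (x : ℕ → ℝ) {w : ℝ} (hw : 0 ≤ w) {q : ℕ} (hq : 0 < q)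
    (hqw : q * w ≤ 1 / 2) (N : ℕ) : tentSum x (q * w) N ≤ (q : ℝ) ^ 2 * tentSum x w N := by
  have hq1 : (1 : ℝ) ≤ q := by exact_mod_cast hq
  have hw2 : w ≤ 1 / 2 := (le_mul_of_one_le_left hw hq1).trans hqw
  rw [← integral_arcCount_sq x hqw, ← integral_arcCount_sq x hw2]
  have hsum : ∀ t, arcCount x (q * w) N t =
      ∑ j ∈ Finset.range q, arcCount x w N (t + j * w) := fun t => by
    unfold arcCount
    rw [Finset.sum_comm]
    refine Finset.sum_congr rfl fun i _ => ?_
    rw [arcInd_natCast_mul hw q (by linarith)]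
    simp_rw [sub_sub]
  have hint : ∀ j : ℕ, IntervalIntegrable (fun t => arcCount x w N (t + j * w) ^ 2) volume 0 1 :=
    fun j => by simpa using (intervalIntegrable_arcCount_sq x w N (0 + j * w)
      (1 + j * w)).comp_add_right (j * w)
  have hshift : ∀ j : ℕ, ∫ t in (0 : ℝ)..1, arcCount x w N (t + j * w) ^ 2 =
      ∫ t in (0 : ℝ)..1, arcCount x w N t ^ 2 := fun j => by
    rw [intervalIntegral.integral_comp_add_right (fun t => arcCount x w N t ^ 2)]
    have hper : Function.Periodic (fun t => arcCount x w N t ^ 2) 1 := fun t => by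
      simp only [arcCount_periodic x w N t]
    have := hper.intervalIntegral_add_eq (j * w) 0
    rw [zero_add] at this
    rw [zero_add, add_comm 1, this]
  calc ∫ t in (0 : ℝ)..1, arcCount x (q * w) N t ^ 2
      ≤ ∫ t in (0 : ℝ)..1, (q : ℝ) * ∑ j ∈ Finset.range q, arcCount x w N (t + j * w) ^ 2 := by
        refine intervalIntegral.integral_mono_on zero_le_one
          (intervalIntegrable_arcCount_sq x (q * w) N 0 1) ?_ fun t _ => ?_
        · refine IntervalIntegrable.const_mul ?_ _
          simpa only [Finset.sum_fn] using IntervalIntegrable.sum (Finset.range q) fun j _ => hint j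
        · rw [hsum]
          simpa using sq_sum_le_card_mul_sum_sq (s := Finset.range q)
            (f := fun j : ℕ => arcCount x w N (t + j * w))
    _ = (q : ℝ) ^ 2 * ∫ t in (0 : ℝ)..1, arcCount x w N t ^ 2 := by
        rw [intervalIntegral.integral_const_mul,
          intervalIntegral.integral_finsetSum fun j _ => hint j]
        simp_rw [hshift]
        simp only [Finset.sum_const, Finset.card_range, nsmul_eq_mul]
        ring

/-! ### Between tent sums and pair correlations -/

/-- The number of ordered pairs among the first `N` terms, including equal indices, at distance at
most `w` modulo `1`. -/
def closeCount (x : ℕ → ℝ) (w : ℝ) (N : ℕ) : ℝ :=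
  ∑ i : Fin N, ∑ j : Fin N, if distInt (x i - x j) ≤ w then (1 : ℝ) else 0

theorem closeCount_eq (β : ℝ) (x : ℕ → ℝ) {s : ℝ} (hs : 0 ≤ s) {N : ℕ} (hN : 0 < N) :
    closeCount x (s / (N : ℝ) ^ β) N = N + (N : ℝ) ^ (2 - β) * pairCorr β x s N := by
  classical
  have hN' : (0 : ℝ) < N := by exact_mod_cast hN
  have hpos : (0 : ℝ) < (N : ℝ) ^ (2 - β) := Real.rpow_pos_of_pos hN' _
  unfold pairCorr
  rw [← mul_assoc, mul_one_div_cancel hpos.ne', one_mul, Set.ncard_eq_toFinset_card',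
    Set.toFinset_ofPred, Finset.card_filter, Fintype.sum_prod_type]
  push_cast
  have hdiag : (N : ℝ) = ∑ i : Fin N, ∑ j : Fin N, if i = j then (1 : ℝ) else 0 := by simp
  rw [hdiag, ← Finset.sum_add_distrib]
  refine Finset.sum_congr rfl fun i _ => ?_
  rw [← Finset.sum_add_distrib]
  refine Finset.sum_congr rfl fun j _ => ?_
  rw [← hdiag]
  by_cases hij : i = j
  · subst hij
    have : distInt 0 ≤ s / (N : ℝ) ^ β := by
      rw [distInt_zero]
      positivity
    simp [this]
  · simp [hij]

/-- The pair sum of the tent function of width `r / N ^ α`, normalized to have limit `r ^ 2` for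
equidistributed points. -/
def scaledTent (α : ℝ) (x : ℕ → ℝ) (r : ℝ) (N : ℕ) : ℝ :=
  tentSum x (r / (N : ℝ) ^ α) N / (N : ℝ) ^ (2 - 2 * α)

theorem rpow_two_sub_two_mul {N : ℕ} (hN : 0 < N) (α : ℝ) :
    (N : ℝ) ^ (2 - 2 * α) = (N : ℝ) ^ 2 / ((N : ℝ) ^ α) ^ 2 := by
  have hN' : (0 : ℝ) < N := by exact_mod_cast hN
  rw [Real.rpow_sub hN', mul_comm 2 α, Real.rpow_mul hN'.le]
  norm_num

theorem rpow_two_sub {N : ℕ} (hN : 0 < N) (α : ℝ) :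
    (N : ℝ) ^ (2 - α) = (N : ℝ) ^ 2 / (N : ℝ) ^ α := by
  have hN' : (0 : ℝ) < N := by exact_mod_cast hN
  rw [Real.rpow_sub hN']
  norm_num

theorem rpow_sub_one {N : ℕ} (hN : 0 < N) (α : ℝ) :
    (N : ℝ) ^ (α - 1) = (N : ℝ) ^ α / N := by
  have hN' : (0 : ℝ) < N := by exact_mod_cast hN
  rw [Real.rpow_sub hN', Real.rpow_one]

theorem tendsto_rpow_sub_one {α : ℝ} (hα : α < 1) :
    Tendsto (fun N : ℕ => (N : ℝ) ^ (α - 1)) atTop (𝓝 0) := by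
  have := (tendsto_rpow_neg_atTop (y := 1 - α) (by linarith)).comp tendsto_natCast_atTop_atTop
  simpa [Function.comp_def] using this

theorem sq_le_scaledTent (α : ℝ) (x : ℕ → ℝ) {r : ℝ} (hr : 0 ≤ r) {N : ℕ} (hN : 0 < N)
    (h : r / (N : ℝ) ^ α ≤ 1 / 2) : r ^ 2 ≤ scaledTent α x r N := by
  have hN' : (0 : ℝ) < N := by exact_mod_cast hN
  have hpos : (0 : ℝ) < (N : ℝ) ^ α := Real.rpow_pos_of_pos hN' _
  unfold scaledTent
  rw [le_div_iff₀ (Real.rpow_pos_of_pos hN' _), rpow_two_sub_two_mul hN]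
  refine le_trans (le_of_eq ?_) (sq_le_tentSum x (by positivity) h N)
  field_simp

theorem eventually_div_rpow_le_half {α r : ℝ} (hα : 0 ≤ α) (hr : α = 0 → r ≤ 1 / 2) :
    ∀ᶠ N : ℕ in atTop, r / (N : ℝ) ^ α ≤ 1 / 2 := by
  rcases hα.eq_or_lt with rfl | hα
  · exact Eventually.of_forall fun N => by simpa using hr rfl
  · have h : Tendsto (fun N : ℕ => r / (N : ℝ) ^ α) atTop (𝓝 0) :=
      Tendsto.const_div_atTop ((tendsto_rpow_atTop hα).comp tendsto_natCast_atTop_atTop) r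
    exact h.eventually_le_const (by norm_num)

/-- As a function of its width the tent has derivative 1 where d < w and 0 where d > w, so
difference quotients on either side of w bracket the cutoff. -/
theorem tent_sub_tent_le (d w h : ℝ) :
    max (w - d) 0 - max (w - h - d) 0 ≤ h * if d ≤ w then 1 else 0 := by
  split_ifs with hd
  · rw [max_eq_left (by linarith)]
    linarith [le_max_left (w - h - d) 0]
  · rw [max_eq_right (by linarith)]
    linarith [le_max_right (w - h - d) 0]

theorem le_tent_sub_tent (d w h : ℝ) :
    (h * if d ≤ w then 1 else 0) ≤ max (w + h - d) 0 - max (w - d) 0 := by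
  split_ifs with hd
  · rw [max_eq_left (by linarith : 0 ≤ w - d)]
    linarith [le_max_left (w + h - d) 0]
  · rw [max_eq_right (by linarith : w - d ≤ 0)]
    linarith [le_max_right (w + h - d) 0]

theorem tentSum_sub_tentSum_le (x : ℕ → ℝ) (w h : ℝ) (N : ℕ) :
    tentSum x w N - tentSum x (w - h) N ≤ h * closeCount x w N := by
  unfold tentSum closeCount
  simp only [← Finset.sum_sub_distrib, Finset.mul_sum]
  exact Finset.sum_le_sum fun _ _ => Finset.sum_le_sum fun _ _ => tent_sub_tent_le _ _ _

theorem le_tentSum_sub_tentSum (x : ℕ → ℝ) (w h : ℝ) (N : ℕ) :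
    h * closeCount x w N ≤ tentSum x (w + h) N - tentSum x w N := by
  unfold tentSum closeCount
  simp only [← Finset.sum_sub_distrib, Finset.mul_sum]
  exact Finset.sum_le_sum fun _ _ => Finset.sum_le_sum fun _ _ => le_tent_sub_tent _ _ _

theorem scaledTent_sub_le (α : ℝ) (x : ℕ → ℝ) {r : ℝ} (hr : 0 ≤ r) (η : ℝ) {N : ℕ}
    (hN : 0 < N) : scaledTent α x r N - scaledTent α x (r - η) N ≤
      η * ((N : ℝ) ^ (α - 1) + pairCorr α x r N) := by
  have hN' : (0 : ℝ) < N := by exact_mod_cast hN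
  have hpos : (0 : ℝ) < (N : ℝ) ^ α := Real.rpow_pos_of_pos hN' _
  have h := tentSum_sub_tentSum_le x (r / (N : ℝ) ^ α) (η / (N : ℝ) ^ α) N
  rw [closeCount_eq α x hr hN, ← sub_div, rpow_two_sub hN] at h
  unfold scaledTent
  rw [← sub_div, div_le_iff₀ (Real.rpow_pos_of_pos hN' _), rpow_two_sub_two_mul hN,
    rpow_sub_one hN]
  refine h.trans (le_of_eq ?_)
  field_simp

theorem le_scaledTent_sub (α : ℝ) (x : ℕ → ℝ) {r : ℝ} (hr : 0 ≤ r) (η : ℝ) {N : ℕ}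
    (hN : 0 < N) : η * ((N : ℝ) ^ (α - 1) + pairCorr α x r N) ≤
      scaledTent α x (r + η) N - scaledTent α x r N := by
  have hN' : (0 : ℝ) < N := by exact_mod_cast hN
  have hpos : (0 : ℝ) < (N : ℝ) ^ α := Real.rpow_pos_of_pos hN' _
  have h := le_tentSum_sub_tentSum x (r / (N : ℝ) ^ α) (η / (N : ℝ) ^ α) N
  rw [closeCount_eq α x hr hN, ← add_div, rpow_two_sub hN] at h
  unfold scaledTent
  rw [← sub_div, le_div_iff₀ (Real.rpow_pos_of_pos hN' _), rpow_two_sub_two_mul hN,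
    rpow_sub_one hN]
  refine le_trans (le_of_eq ?_) h
  field_simp

theorem tentSum_zero (x : ℕ → ℝ) (N : ℕ) : tentSum x 0 N = 0 := by
  simp [tentSum, distInt_nonneg]

/-- Telescoping over K equal steps in the width, each increment bounded by the pair count at its
right endpoint; N^(β-1) is the contribution of the diagonal. -/
theorem scaledTent_le_sum (β : ℝ) (x : ℕ → ℝ) {r : ℝ} (hr : 0 ≤ r) {K : ℕ} (hK : 0 < K) {N : ℕ}
    (hN : 0 < N) : scaledTent β x r N ≤ ∑ l ∈ Finset.range K,
      r / K * ((N : ℝ) ^ (β - 1) + pairCorr β x ((l + 1) * (r / K)) N) := by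
  have htel := Finset.sum_range_sub (fun l : ℕ => scaledTent β x (l * (r / K)) N) K
  have h0 : scaledTent β x ((0 : ℕ) * (r / K)) N = 0 := by
    simp [scaledTent, tentSum_zero]
  have hKr : (K : ℝ) * (r / K) = r := by field_simp
  rw [h0, sub_zero, hKr] at htel
  rw [← htel]
  refine Finset.sum_le_sum fun l _ => ?_
  have h := scaledTent_sub_le β x (r := (l + 1) * (r / K)) (by positivity) (r / K) hN
  rw [show ((l : ℝ) + 1) * (r / K) - r / K = l * (r / K) by ring] at h
  simpa using h

/-- An asymptotic upper bound for the pair correlations on all scales determines the tent sums. -/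
theorem tendsto_scaledTent_self {β : ℝ} (hβ0 : 0 ≤ β) (hβ1 : β < 1) {x : ℕ → ℝ}
    (hU : ∀ s : ℝ, 0 < s → (β = 0 → s ≤ 1 / 2) → ∀ c, 2 * s < c →
      ∀ᶠ N in atTop, pairCorr β x s N < c)
    {r : ℝ} (hr : 0 < r) (hr' : β = 0 → r ≤ 1 / 2) :
    Tendsto (fun N => scaledTent β x r N) atTop (𝓝 (r ^ 2)) := by
  refine tendsto_order.2 ⟨fun c hc => ?_, fun c hc => ?_⟩
  · filter_upwards [eventually_gt_atTop 0, eventually_div_rpow_le_half hβ0 hr'] with N hN h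
    exact hc.trans_le (sq_le_scaledTent β x hr.le hN h)
  -- Allowing an error 1/K for both the diagonal and the pair correlation, the Riemann sum of 2s
  -- over [0, r] equals r^2 + (r^2 + 2r)/K.
  · obtain ⟨K, hK, hKc⟩ : ∃ K : ℕ, 0 < K ∧ r ^ 2 + (r ^ 2 + 2 * r) / K < c := by
      have h : Tendsto (fun K : ℕ => r ^ 2 + (r ^ 2 + 2 * r) / K) atTop (𝓝 (r ^ 2 + 0)) :=
        (tendsto_const_div_atTop_nhds_zero_nat _).const_add _
      obtain ⟨K, h1, h2⟩ := ((h.eventually_lt_const (by simpa using hc)).and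
        (eventually_gt_atTop 0)).exists
      exact ⟨K, h2, h1⟩
    have hK' : (0 : ℝ) < K := by exact_mod_cast hK
    have hall : ∀ᶠ N in atTop, ∀ l ∈ Finset.range K,
        pairCorr β x ((l + 1) * (r / K)) N < 2 * ((l + 1) * (r / K)) + 1 / K := by
      refine (Finset.eventually_all _).2 fun l hl => hU _ (by positivity) (fun h0 => ?_) _ ?_
      · refine le_trans ?_ (hr' h0)
        have : ((l : ℝ) + 1) ≤ K := by exact_mod_cast Finset.mem_range.1 hl
        calc ((l : ℝ) + 1) * (r / K) ≤ K * (r / K) := by gcongr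
          _ = r := by field_simp
      · have : 0 < 1 / (K : ℝ) := by positivity
        linarith
    filter_upwards [eventually_gt_atTop 0, hall, (tendsto_rpow_sub_one hβ1).eventually_lt_const
      (by positivity : (0 : ℝ) < 1 / K)] with N hN h1 h2
    refine lt_of_le_of_lt ?_ hKc
    calc scaledTent β x r N ≤ ∑ l ∈ Finset.range K,
          r / K * ((N : ℝ) ^ (β - 1) + pairCorr β x ((l + 1) * (r / K)) N) :=
          scaledTent_le_sum β x hr.le hK hN
      _ ≤ ∑ l ∈ Finset.range K, r / K * (1 / K + (2 * ((l + 1) * (r / K)) + 1 / K)) := by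
          refine Finset.sum_le_sum fun l hl => ?_
          have := h1 l hl
          gcongr
      _ = r ^ 2 + (r ^ 2 + 2 * r) / K := by
          have hg : ∀ n : ℕ, ∑ l ∈ Finset.range n, ((l : ℝ) + 1) = n * (n + 1) / 2 := fun n => by
            induction n with
            | zero => simp
            | succ n ih =>
              rw [Finset.sum_range_succ, ih]
              push_cast
              ring
          have : ∀ l : ℕ, r / K * (1 / K + (2 * ((l + 1) * (r / K)) + 1 / K)) =
              2 * (r / K) ^ 2 * ((l : ℝ) + 1) + 2 * r / K ^ 2 := fun l => by
            field_simp
            ring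
          simp_rw [this]
          rw [Finset.sum_add_distrib, ← Finset.mul_sum, hg]
          simp only [Finset.sum_const, Finset.card_range, nsmul_eq_mul]
          field_simp
          ring

/-- Convergence of tent sums passes to coarser scales. -/
theorem tendsto_scaledTent_of_le {α β : ℝ} (hα : 0 ≤ α) (hαβ : α ≤ β) {x : ℕ → ℝ} {r : ℝ}
    (hr : 0 < r) (hr' : α = 0 → r ≤ 1 / 2)
    (h : Tendsto (fun N => scaledTent β x r N) atTop (𝓝 (r ^ 2))) :
    Tendsto (fun N => scaledTent α x r N) atTop (𝓝 (r ^ 2)) := by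
  have hceil : Tendsto (fun N : ℕ => (⌈(N : ℝ) ^ (β - α)⌉₊ : ℝ) / (N : ℝ) ^ (β - α)) atTop
      (𝓝 1) := by
    rcases hαβ.eq_or_lt with rfl | hlt
    · simp
    · exact (tendsto_nat_ceil_div_atTop (R := ℝ)).comp
        ((tendsto_rpow_atTop (sub_pos.2 hlt)).comp tendsto_natCast_atTop_atTop)
  have hup := h.mul (hceil.pow 2)
  rw [one_pow, mul_one] at hup
  refine tendsto_of_tendsto_of_tendsto_of_le_of_le' tendsto_const_nhds hup ?_ ?_
  · filter_upwards [eventually_gt_atTop 0, eventually_div_rpow_le_half hα hr'] with N hN h1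
    exact sq_le_scaledTent α x hr.le hN h1
  · filter_upwards [eventually_gt_atTop 0, eventually_div_rpow_le_half hα hr'] with N hN h1
    have hN' : (0 : ℝ) < N := by exact_mod_cast hN
    have hposα : (0 : ℝ) < (N : ℝ) ^ α := Real.rpow_pos_of_pos hN' _
    have hposβ : (0 : ℝ) < (N : ℝ) ^ β := Real.rpow_pos_of_pos hN' _
    have hdiv : (N : ℝ) ^ (β - α) = (N : ℝ) ^ β / (N : ℝ) ^ α := Real.rpow_sub hN' _ _
    -- Each arc on scale α is cut into q arcs of length at most r / N^β. Rounding up allows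
    -- `tentSum_mono`, and costs only the square of a ratio tending to 1.
    set q := ⌈(N : ℝ) ^ (β - α)⌉₊ with hq
    have hq0 : 0 < q := Nat.ceil_pos.2 (Real.rpow_pos_of_pos hN' _)
    have hq0' : (0 : ℝ) < q := by exact_mod_cast hq0
    have hqle : (N : ℝ) ^ β / (N : ℝ) ^ α ≤ q := hdiv ▸ Nat.le_ceil _
    have hw : (q : ℝ) * (r / (N : ℝ) ^ α / q) = r / (N : ℝ) ^ α := by field_simp
    have h2 := tentSum_natCast_mul_le x (w := r / (N : ℝ) ^ α / q) (by positivity) hq0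
      (hw.le.trans h1) N
    rw [hw] at h2
    have h3 : r / (N : ℝ) ^ α / q ≤ r / (N : ℝ) ^ β := by
      rw [div_div]
      rw [div_le_iff₀ hposα, mul_comm] at hqle
      gcongr
    have h4 := h2.trans (mul_le_mul_of_nonneg_left (tentSum_mono x h3 N) (by positivity))
    unfold scaledTent
    rw [rpow_two_sub_two_mul hN, rpow_two_sub_two_mul hN, hdiv,
      div_le_iff₀ (by positivity)]
    refine h4.trans (le_of_eq ?_)
    field_simp

theorem pairCorr_zero_le_one (x : ℕ → ℝ) (s : ℝ) {N : ℕ} (hN : 0 < N) : pairCorr 0 x s N ≤ 1 := by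
  have hN' : (0 : ℝ) < N := by exact_mod_cast hN
  have h : closeCount x (s / (N : ℝ) ^ (0 : ℝ)) N ≤ (N : ℝ) ^ 2 := by
    unfold closeCount
    calc _ ≤ ∑ _i : Fin N, ∑ _j : Fin N, (1 : ℝ) :=
          Finset.sum_le_sum fun _ _ => Finset.sum_le_sum fun _ _ => by split_ifs <;> norm_num
      _ = _ := by simp [sq]
  have h0 : pairCorr 0 x s N = 1 / (N : ℝ) ^ 2 * (Set.ncard {p : Fin N × Fin N |
      p.1 ≠ p.2 ∧ distInt (x p.1 - x p.2) ≤ s / (N : ℝ) ^ (0 : ℝ)} : ℝ) := by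
    unfold pairCorr
    norm_num
  rw [h0, one_div, inv_mul_le_iff₀ (by positivity), mul_one]
  have h1 := Set.ncard_le_card {p : Fin N × Fin N |
      p.1 ≠ p.2 ∧ distInt (x p.1 - x p.2) ≤ s / (N : ℝ) ^ (0 : ℝ)}
  rw [Nat.card_eq_fintype_card, Fintype.card_prod, Fintype.card_fin, ← sq] at h1
  exact_mod_cast h1

/-- Difference quotients of the tent sum in its width trap the pair correlation up to the vanishing
diagonal, and those of r^2 at s are 2s ± η. -/
theorem HasPPC.of_tendsto_scaledTent {α : ℝ} (hα1 : α < 1) {x : ℕ → ℝ}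
    (h : ∀ r : ℝ, 0 < r → (α = 0 → r ≤ 1 / 2) →
      Tendsto (fun N => scaledTent α x r N) atTop (𝓝 (r ^ 2))) : HasPPC α x := by
  intro s hs hs'
  refine tendsto_order.2 ⟨fun c hc => ?_, fun c hc => ?_⟩
  · set η := min (s / 2) ((2 * s - c) / 2)
    have hη : 0 < η := lt_min (by linarith) (by linarith)
    have hη1 : η ≤ s / 2 := min_le_left _ _
    have hη2 : η ≤ (2 * s - c) / 2 := min_le_right _ _
    have hlim : Tendsto (fun N : ℕ => (scaledTent α x s N - scaledTent α x (s - η) N) / η -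
        (N : ℝ) ^ (α - 1)) atTop (𝓝 ((s ^ 2 - (s - η) ^ 2) / η - 0)) :=
      (((h s hs hs').sub (h (s - η) (by linarith)
        fun h0 => by linarith [hs' h0])).div_const η).sub (tendsto_rpow_sub_one hα1)
    have hval : (s ^ 2 - (s - η) ^ 2) / η - 0 = 2 * s - η := by
      field_simp
      ring
    rw [hval] at hlim
    filter_upwards [hlim.eventually_const_lt (u := c) (by linarith), eventually_gt_atTop 0]
      with N h1 hN
    refine h1.trans_le ?_
    rw [sub_le_iff_le_add', div_le_iff₀' hη]
    exact scaledTent_sub_le α x hs.le η hN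
  -- For α = 0 and s = 1/2 no larger admissible width exists, but there the trivial bound 1 = 2s
  -- suffices.
  · by_cases hedge : α = 0 ∧ s = 1 / 2
    · obtain ⟨rfl, rfl⟩ := hedge
      filter_upwards [eventually_gt_atTop 0] with N hN
      exact (pairCorr_zero_le_one x _ hN).trans_lt (by linarith)
    · obtain ⟨δ, hδ, hδ'⟩ : ∃ δ : ℝ, 0 < δ ∧ (α = 0 → s + δ ≤ 1 / 2) := by
        by_cases h0 : α = 0
        · have h1 : s < 1 / 2 := lt_of_le_of_ne (hs' h0) fun h2 => hedge ⟨h0, h2⟩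
          exact ⟨1 / 2 - s, by linarith, fun _ => by linarith⟩
        · exact ⟨1, one_pos, fun h => absurd h h0⟩
      set η := min δ ((c - 2 * s) / 2)
      have hη : 0 < η := lt_min hδ (by linarith)
      have hη1 : η ≤ δ := min_le_left _ _
      have hη2 : η ≤ (c - 2 * s) / 2 := min_le_right _ _
      have hlim : Tendsto (fun N : ℕ => (scaledTent α x (s + η) N - scaledTent α x s N) / η)
          atTop (𝓝 (((s + η) ^ 2 - s ^ 2) / η)) :=
        ((h (s + η) (by linarith) fun h0 => by linarith [hδ' h0]).sub (h s hs hs')).div_const η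
      have hval : ((s + η) ^ 2 - s ^ 2) / η = 2 * s + η := by
        field_simp
        ring
      rw [hval] at hlim
      filter_upwards [hlim.eventually_lt_const (u := c) (by linarith), eventually_gt_atTop 0]
        with N h1 hN
      refine lt_of_le_of_lt ?_ h1
      rw [le_div_iff₀' hη]
      refine le_trans ?_ (le_scaledTent_sub α x hs.le η hN)
      have : 0 ≤ (N : ℝ) ^ (α - 1) := by positivity
      gcongr
      linarith

/-! ### Uniform distribution from vanishing variance -/

/-- The number of the first `N` terms of `x` in `[a, b]`. -/
def termCount (x : ℕ → ℝ) (a b : ℝ) (N : ℕ) : ℝ :=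
  ∑ i : Fin N, (Set.Icc a b).indicator (fun _ => (1 : ℝ)) (x i)

theorem ncard_eq_termCount (x : ℕ → ℝ) (a b : ℝ) (N : ℕ) :
    (Set.ncard {n : Fin N | x n ∈ Set.Icc a b} : ℝ) = termCount x a b N := by
  classical
  rw [Set.ncard_eq_toFinset_card', Set.toFinset_ofPred, Finset.card_filter]
  push_cast
  refine Finset.sum_congr rfl fun i _ => ?_
  rw [Set.indicator_apply]

/-- For t between a and b - w the arc [t, t+w) stays inside [a, b], so it misses any y outside. As b
≤ 1 and y ≥ 0, wrapping does not reach y either. -/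
theorem integral_arcInd_le_indicator {a b w y : ℝ} (ha : 0 ≤ a) (hb : b ≤ 1) (hw : 0 ≤ w)
    (hw2 : w ≤ 1 / 2) (hab : a ≤ b - w) (hy : y ∈ Set.Icc (0 : ℝ) 1) :
    ∫ t in a..(b - w), arcInd w (y - t) ≤ w * (Set.Icc a b).indicator (fun _ => (1 : ℝ)) y := by
  by_cases hmem : y ∈ Set.Icc a b
  · rw [Set.indicator_of_mem hmem, mul_one]
    refine le_of_le_of_eq ?_ (integral_arcInd y hw hw2)
    exact intervalIntegral.integral_mono_interval ha hab (by linarith)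
      (ae_of_all _ fun _ => arcInd_nonneg _ _) (intervalIntegrable_arcInd w y 0 1)
  · rw [Set.indicator_of_notMem hmem, mul_zero, intervalIntegral.integral_of_le hab]
    refine (setIntegral_eq_zero_of_forall_eq_zero fun t ht => ?_).le
    obtain ⟨ht1, ht2⟩ := ht
    obtain ⟨hy0, hy1⟩ := hy
    unfold arcInd
    rw [if_neg]
    rcases lt_or_ge y a with h | h
    · rw [← Int.fract_add_one, Int.fract_eq_self.2 ⟨by linarith, by linarith⟩]
      linarith
    · have h2 : b < y := not_le.1 fun h3 => hmem ⟨h, h3⟩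
      rw [Int.fract_eq_self.2 ⟨by linarith, by linarith⟩]
      linarith

theorem integral_arcCount_le {x : ℕ → ℝ} (hx : ∀ n, x n ∈ Set.Icc (0 : ℝ) 1) {a b w : ℝ}
    (ha : 0 ≤ a) (hb : b ≤ 1) (hw : 0 ≤ w) (hw2 : w ≤ 1 / 2) (hab : a ≤ b - w) (N : ℕ) :
    ∫ t in a..(b - w), arcCount x w N t ≤ w * termCount x a b N := by
  unfold arcCount termCount
  rw [intervalIntegral.integral_finsetSum fun (i : Fin N) _ =>
    intervalIntegrable_arcInd w (x i) _ _, Finset.mul_sum]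
  exact Finset.sum_le_sum fun i _ => integral_arcInd_le_indicator ha hb hw hw2 hab (hx i)

/-- The deviation u of the count from its mean satisfies u ≥ -(e + u^2/e), so its integral is
controlled by the variance. -/
theorem le_integral_arcCount (x : ℕ → ℝ) {a b w e : ℝ} (ha : 0 ≤ a) (hb : b ≤ 1) (hw : 0 ≤ w)
    (hw2 : w ≤ 1 / 2) (hab : a ≤ b - w) (he : 0 < e) (N : ℕ) :
    (b - w - a) * (w * N) - (e + e⁻¹ * (tentSum x w N - (w * N) ^ 2)) ≤
      ∫ t in a..(b - w), arcCount x w N t := by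
  have hcont : ∀ c d, IntervalIntegrable (fun t => e + e⁻¹ * (arcCount x w N t - w * N) ^ 2)
      volume c d := fun c d => by
    refine intervalIntegrable_const.add (IntervalIntegrable.const_mul ?_ _)
    have h : (fun t => (arcCount x w N t - w * N) ^ 2) = fun t =>
      arcCount x w N t ^ 2 - 2 * (w * N) * arcCount x w N t + (w * N) ^ 2 := by
      ext t
      ring
    rw [h]
    exact ((intervalIntegrable_arcCount_sq x w N c d).sub
      ((intervalIntegrable_arcCount x w N c d).const_mul _)).add intervalIntegrable_const
  have h1 : ∫ t in a..(b - w), (e + e⁻¹ * (arcCount x w N t - w * N) ^ 2) ≤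
      e + e⁻¹ * (tentSum x w N - (w * N) ^ 2) := by
    refine (intervalIntegral.integral_mono_interval ha hab (by linarith : b - w ≤ 1)
      (ae_of_all _ fun t => ?_) (hcont 0 1)).trans (le_of_eq ?_)
    · change 0 ≤ e + e⁻¹ * (arcCount x w N t - w * N) ^ 2
      positivity
    · have h2 : IntervalIntegrable (fun t => e⁻¹ * (arcCount x w N t - w * N) ^ 2) volume 0 1 := by
        simpa using (hcont 0 1).sub (intervalIntegrable_const (c := e))
      rw [intervalIntegral.integral_add intervalIntegrable_const h2,
        intervalIntegral.integral_const_mul, integral_arcCount_variance x hw hw2,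
        intervalIntegral.integral_const]
      simp
  have h3 : ∫ t in a..(b - w), (w * N - (e + e⁻¹ * (arcCount x w N t - w * N) ^ 2)) ≤
      ∫ t in a..(b - w), arcCount x w N t := by
    refine intervalIntegral.integral_mono_on hab (intervalIntegrable_const.sub (hcont _ _))
      (intervalIntegrable_arcCount x w N _ _) fun t _ => ?_
    set u := arcCount x w N t - w * N with hu
    have h4 : 0 ≤ e⁻¹ * ((u + e / 2) ^ 2 + 3 / 4 * e ^ 2) := by positivity
    have h5 : e⁻¹ * ((u + e / 2) ^ 2 + 3 / 4 * e ^ 2) = e⁻¹ * u ^ 2 + u + e := by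
      field_simp
      ring
    linarith
  rw [intervalIntegral.integral_sub intervalIntegrable_const (hcont _ _),
    intervalIntegral.integral_const, smul_eq_mul] at h3
  linarith

theorem termCount_nonneg (x : ℕ → ℝ) (a b : ℝ) (N : ℕ) : 0 ≤ termCount x a b N :=
  Finset.sum_nonneg fun _ _ => Set.indicator_nonneg (fun _ _ => zero_le_one) _

theorem eventually_lt_termCount_div {x : ℕ → ℝ} (hx : ∀ n, x n ∈ Set.Icc (0 : ℝ) 1)
    (h : ∀ r : ℝ, 0 < r → r ≤ 1 / 2 → Tendsto (fun N => scaledTent 0 x r N) atTop (𝓝 (r ^ 2)))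
    {a b c : ℝ} (ha : 0 ≤ a) (hb : b ≤ 1) (hc : c < b - a) :
    ∀ᶠ N : ℕ in atTop, c < termCount x a b N / N := by
  -- Negative c is trivial and covers empty intervals; c ≥ 0 guarantees a ≤ b - w below.
  rcases lt_or_ge c 0 with hc0 | hc0
  · exact Eventually.of_forall fun N =>
      hc0.trans_le (div_nonneg (termCount_nonneg x a b N) (Nat.cast_nonneg N))
  obtain ⟨w, hw, hw2, hwc⟩ : ∃ w : ℝ, 0 < w ∧ w ≤ 1 / 2 ∧ c < b - a - 2 * w := by
    refine ⟨min (1 / 2) ((b - a - c) / 3), lt_min (by norm_num) (by linarith), min_le_left _ _, ?_⟩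
    have := min_le_right (1 / 2) ((b - a - c) / 3)
    linarith
  have hlim : Tendsto (fun N => b - a - 2 * w - (scaledTent 0 x w N - w ^ 2) / w ^ 3) atTop
      (𝓝 (b - a - 2 * w - (w ^ 2 - w ^ 2) / w ^ 3)) :=
    (((h w hw hw2).sub_const _).div_const _).const_sub _
  filter_upwards [hlim.eventually_const_lt (u := c) (by simpa using hwc), eventually_gt_atTop 0]
    with N h1 hN
  refine h1.trans_le ?_
  have hN' : (0 : ℝ) < N := by exact_mod_cast hN
  -- With e = w^2 N, division by wN turns the error into w plus (`scaledTent` - w^2) / w^3.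
  have h2 := (le_integral_arcCount x ha hb hw.le hw2 (by linarith)
    (by positivity : 0 < w ^ 2 * N) N).trans
    (integral_arcCount_le hx ha hb hw.le hw2 (by linarith) N)
  have h3 : tentSum x w N = scaledTent 0 x w N * N ^ 2 := by
    unfold scaledTent
    norm_num
    field_simp
  rw [h3] at h2
  rw [le_div_iff₀ hN', ← mul_le_mul_iff_right₀ hw]
  refine le_trans (le_of_eq ?_) h2
  field_simp
  ring

theorem IsUniformlyDistributed.of_tendsto_scaledTent {x : ℕ → ℝ}
    (hx : ∀ n, x n ∈ Set.Icc (0 : ℝ) 1)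
    (h : ∀ r : ℝ, 0 < r → r ≤ 1 / 2 → Tendsto (fun N => scaledTent 0 x r N) atTop (𝓝 (r ^ 2))) :
    IsUniformlyDistributed x := by
  intro a b ha hab hb
  have hcount : ∀ N : ℕ, 1 / (N : ℝ) * (Set.ncard {n : Fin N | x n ∈ Set.Icc a b} : ℝ) =
      termCount x a b N / N := fun N => by
    rw [ncard_eq_termCount, one_div, div_eq_inv_mul]
  simp_rw [hcount]
  refine tendsto_order.2 ⟨fun c hc => eventually_lt_termCount_div hx h ha hb hc, fun c hc => ?_⟩
  -- The upper bound comes from lower bounds on the complement. Gaps of η make the three closed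
  -- intervals disjoint; the outer two lose 2η each, leaving b - a + 4η < c.
  set η := (c - (b - a)) / 5 with hη
  have hη0 : 0 < η := by
    rw [hη]
    linarith
  filter_upwards [eventually_gt_atTop 0,
    eventually_lt_termCount_div hx h (a := 0) (b := a - η) (c := a - 2 * η) le_rfl (by linarith)
      (by linarith),
    eventually_lt_termCount_div hx h (a := b + η) (b := 1) (c := 1 - b - 2 * η) (by linarith) le_rfl
      (by linarith)] with N hN h1 h2
  have hN' : (0 : ℝ) < N := by exact_mod_cast hN
  have h3 : termCount x 0 (a - η) N + termCount x a b N + termCount x (b + η) 1 N ≤ N := by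
    have : (N : ℝ) = ∑ _i : Fin N, (1 : ℝ) := by simp
    rw [this]
    unfold termCount
    rw [← Finset.sum_add_distrib, ← Finset.sum_add_distrib]
    refine Finset.sum_le_sum fun i _ => ?_
    simp only [Set.indicator_apply, Set.mem_Icc]
    split_ifs <;> linarith
  have h4 : termCount x 0 (a - η) N / N + termCount x a b N / N + termCount x (b + η) 1 N / N ≤
      1 := by
    rw [← add_div, ← add_div, div_le_one hN']
    exact h3
  linarith

end WeakCorr

end

theorem theorem8 (k : ℕ) (hk : 2 < k) (β : ℝ) (hβ0 : 0 ≤ β) (hβ1 : β < 1)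
    (x : ℕ → ℝ) (hx : ∀ n, x n ∈ Set.Icc (0 : ℝ) 1)
    (h : WeakCorr.HasPoissonianCorr k β x) :
    WeakCorr.HasPoissonianCorr (k - 1) β x ∧
      (∀ α : ℝ, 0 ≤ α → α ≤ β → WeakCorr.HasPPC α x) ∧
      WeakCorr.IsUniformlyDistributed x := by
  obtain ⟨j, rfl⟩ : ∃ j, k = j + 3 := ⟨k - 3, by omega⟩
  have htent : ∀ α, 0 ≤ α → α ≤ β → ∀ r : ℝ, 0 < r → (α = 0 → r ≤ 1 / 2) →
      Filter.Tendsto (fun N => WeakCorr.scaledTent α x r N) Filter.atTop (nhds (r ^ 2)) := by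
    intro α hα hαβ r hr hr'
    refine WeakCorr.tendsto_scaledTent_of_le hα hαβ hr hr'
      -- If β = 0 then α = 0 as well, so the restriction r ≤ 1/2 is available.
      (WeakCorr.tendsto_scaledTent_self hβ0 hβ1 ?_ hr fun h0 => hr' (by linarith))
    exact fun s hs hs' c hc => WeakCorr.eventually_pairCorr_lt hβ1 (m := j + 1) h hs hs' hc
  have hPPC : ∀ α : ℝ, 0 ≤ α → α ≤ β → WeakCorr.HasPPC α x := fun α hα hαβ =>
    WeakCorr.HasPPC.of_tendsto_scaledTent (by linarith) (htent α hα hαβ)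
  refine ⟨h.pred hβ1 (hPPC β hβ0 le_rfl), hPPC, ?_⟩
  exact WeakCorr.IsUniformlyDistributed.of_tendsto_scaledTent hx fun r hr hr' =>
    htent 0 le_rfl hβ0 r hr fun _ => hr'
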